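/- Let $A$ be a finite alphabet and equip $A^{\mathbb Z}$ with the metric $d(\omega,\gamma)=e^{-\min\{|k|:\ \omega_k\neq\gamma_k\}}$ for $\omega\ne\gamma$, $d(\omega,\omega)=0$, and with the shift $(\sigma x)_n=x_{n+1}$. Let $X\subseteq A^{\mathbb Z}$ be a two-sided subshift (a closed shift-invariant set) and put $f=\sigma|_X$. Assume that there are a non-empty compact set $Y\subseteq X$ and an integer $N\ge 1$ such that $f^N(Y)=Y$, $X=\bigcup_{l=0}^{N-1}f^l(Y)$, and $(Y,f^N)$ has the non-uniform specification property. Here a system $(Y,g)$ has the non-uniform specification property if for every $\varepsilon>0$ there are positive integers $p(n)$, $n\ge1$, with $\lim_{n\to\infty}p(n)/n=0$, such that for all $k\ge1$, $x_1,\dots,x_k\in Y$, integers $n_1,\dots,n_k\ge 1$ and integers $p_i\ge p(n_i)$ there is $z\in Y$ with $d\big(g^{\,t}(x_i),g^{\,m_i+t}(z)\big)<\varepsilon$ for all $1\le i\le k$ and $0\le t<n_i$, where $m_i=\sum_{l<i}(n_l+p_l)$. For every $j\ge1$ let $\varphi_j:\mathbb N\to(0,1]$ (where $\mathbb N=\{0,1,2,\dots\}$),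 let $\mathcal Z_j=(z_j^i)_{i\ge0}$ be a sequence in $X$, and let $S_j=(s_j^i)_{i\ge0}$ be a sequence in $\mathbb N$ with $\lim_{i\to\infty}s_j^i=\infty$. Put $$\overline\tau=\sup_{j}\limsup_{n\to\infty}\frac{-\ln\varphi_j(n)}{n},\qquad \underline\tau=\sup_{j}\liminf_{n\to\infty}\frac{-\ln\varphi_j(n)}{n}\qquad(\text{in }[0,\infty]),$$ $$W=\bigcap_{j\ge1}\{x\in X:\ d(f^n(x),z_j^n)<\varphi_j(n)\text{ for infinitely many }n\in S_j\}.$$ Let $\mathrm{Ind}'_j$ be the set of the integers $I_1-I_2$, where $I_1,I_2\in\{0,\dots,N-1\}$ are such that $z_j^{s_j^i}\in f^{I_1}(Y)$ and $N\mid s_j^i-I_2$ for infinitely many $i$. Let $h_{top}(f,X)$ be the classical topological entropy (defined by separated sets), $h_{top}(f,W)$ Bowen's topological entropy of $f$ on the subset $W$, and $\dim_H$ the Hausdorff dimension with respect to $d$. 1. If $\overline\tau<1$ and $\bigcap_{j\ge1}\mathrm{Ind}'_j\neq\emptyset$, then $W\ne\emptyset$, $$\frac{1-\overline\tau}{1+\overline\tau}\,h_{top}(f,X)\le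 h_{top}(f,W)\le\frac{1-\underline\tau}{1+\underline\tau}\,h_{top}(f,X),\qquad \frac{2}{1+\overline\tau}\,h_{top}(f,X)\le\dim_H W\le\frac{2}{1+\underline\tau}\,h_{top}(f,X).$$ If moreover $Y=X$, $N=1$ and $S_j=\mathbb N$ as a set for all $j$ (it is enough that $S_j$ contains every positive integer), then $$h_{top}(f,W)=\frac{1-\underline\tau}{1+\underline\tau}\,h_{top}(f,X),\qquad \dim_H W=\frac{2}{1+\underline\tau}\,h_{top}(f,X).$$ 2. If $\underline\tau=1$, then $h_{top}(f,W)=0$ and $\dim_H W\le h_{top}(f,X)$. 3. If $\underline\tau>1$, then $h_{top}(f,W)=0$ and $\dim_H W=0$. -/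

import Mathlib

open Set Filter Topology
open scoped ENNReal NNReal

/-! ### Dynamics of a map on a subset of a metric space -/

namespace ShrinkingTarget

section Dynamics

variable {M : Type*} [MetricSpace M]

/-- The dynamical (Bowen) ball `B_n(x, ε, f)` of the system `(X, f)`. -/
def dynBall (f : M → M) (X : Set M) (n : ℕ) (x : M) (ε : ℝ) : Set M :=
  {y | y ∈ X ∧ ∀ i < n, dist (f^[i] x) (f^[i] y) < ε}

/-- `E` is an `(n, ε)`-separated subset of `X`. -/
def IsSeparatedIn (f : M → M) (X : Set M) (n : ℕ) (ε : ℝ) (E : Finset M) : Prop :=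
  (E : Set M) ⊆ X ∧ ∀ x ∈ E, ∀ y ∈ E, x ≠ y → ∃ k < n, ε < dist (f^[k] x) (f^[k] y)

/-- `ln s(X, n, ε) / n`, where `s(X, n, ε)` is the maximal cardinality of an `(n, ε)`-separated
subset of `X` (written as the supremum of `ln #E / n` over all such finite sets `E`). -/
noncomputable def separatedRate (f : M → M) (X : Set M) (ε : ℝ) (n : ℕ) : ℝ≥0∞ :=
  ⨆ E : Finset M, ⨆ _ : IsSeparatedIn f X n ε E, ENNReal.ofReal (Real.log (E.card : ℝ) / n)

/-- The classical topological entropy of `(X, f)`. The limit as `ε → 0` is a supremum since the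
quantity increases as `ε` decreases. -/
noncomputable def topEntropy (f : M → M) (X : Set M) : ℝ≥0∞ :=
  ⨆ ε : ℝ, ⨆ _ : 0 < ε, limsup (fun n : ℕ => separatedRate f X ε n) atTop

/-- `C` is (the set of pairs `(x_i, n_i)` of) a countable family of dynamical balls of `(X, f)` of
radius `ε` with `x_i ∈ X` and `n_i ≥ L` that covers `Z`. -/
def IsDynCover (f : M → M) (X Z : Set M) (L : ℕ) (ε : ℝ) (C : Set (M × ℕ)) : Prop :=
  C.Countable ∧ (∀ c ∈ C, c.1 ∈ X ∧ L ≤ c.2) ∧ Z ⊆ ⋃ c ∈ C, dynBall f X c.2 c.1 ε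

/-- `𝓜_{L,ε}^s(Z)`: the infimum of `∑ exp (-s n_i)` over the covers of `Z`. -/
noncomputable def bowenPre (f : M → M) (X Z : Set M) (L : ℕ) (ε : ℝ) (s : ℝ≥0) : ℝ≥0∞ :=
  ⨅ C : Set (M × ℕ), ⨅ _ : IsDynCover f X Z L ε C,
    ∑' c : C, ENNReal.ofReal (Real.exp (-(s : ℝ) * (c.1.2 : ℝ)))

/-- `𝓜_ε^s(Z) = lim_{L → ∞} 𝓜_{L,ε}^s(Z)`, a limit of a nondecreasing sequence. -/
noncomputable def bowenOuter (f : M → M) (X Z : Set M) (ε : ℝ) (s : ℝ≥0) : ℝ≥0∞ :=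
  ⨆ L : ℕ, bowenPre f X Z (L + 1) ε s

/-- `h_top(f, Z, ε) = inf {s ≥ 0 : 𝓜_ε^s(Z) = 0}`. -/
noncomputable def bowenEntropyAt (f : M → M) (X Z : Set M) (ε : ℝ) : ℝ≥0∞ :=
  ⨅ s : ℝ≥0, ⨅ _ : bowenOuter f X Z ε s = 0, (s : ℝ≥0∞)

/-- Bowen's topological entropy of `f` on a (not necessarily compact or invariant) subset `Z` of the
system `(X, f)`: the limit of `h_top(f, Z, ε)` as `ε → 0`, which is a supremum by monotonicity. -/
noncomputable def bowenEntropy (f : M → M) (X Z : Set M) : ℝ≥0∞ :=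
  ⨆ ε : ℝ, ⨆ _ : 0 < ε, bowenEntropyAt f X Z ε

/-- The non-uniform specification property of `(Y, g)` at scale `ε`. The points are
`x 0, …, x (k - 1)` and the values of `x`, `n`, `q` at indices `≥ k` play no role. -/
def NonUniformSpecificationAt (g : M → M) (Y : Set M) (ε : ℝ) : Prop :=
  ∃ p : ℕ → ℕ, (∀ n, 1 ≤ n → 0 < p n) ∧
    Tendsto (fun n : ℕ => (p n : ℝ) / n) atTop (𝓝 0) ∧
    ∀ (k : ℕ) (x : ℕ → M) (n q : ℕ → ℕ), 1 ≤ k →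
      (∀ i < k, x i ∈ Y ∧ 1 ≤ n i ∧ p (n i) ≤ q i) →
      ∃ z ∈ Y, ∀ i < k,
        g^[∑ l ∈ Finset.range i, (n l + q l)] z ∈ dynBall g Y (n i) (x i) ε

/-- The non-uniform specification property of `(Y, g)`: it holds at every scale. -/
def NonUniformSpecification (g : M → M) (Y : Set M) : Prop :=
  ∀ ε : ℝ, 0 < ε → NonUniformSpecificationAt g Y ε

/-- The shrinking target set `𝔖(f, φ, 𝓩, S)` of the system `(X, f)`. -/
def shrinkingTargetSet (f : M → M) (X : Set M) (φ : ℕ → ℝ) (z : ℕ → M) (S : Set ℕ) : Set M :=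
  {x | x ∈ X ∧ {n | n ∈ S ∧ dist (f^[n] x) (z n) < φ n}.Infinite}

/-- The index set `Ind(𝓩, S, Y)`, for a sequence `S = (s i)`. -/
def indexSet (f : M → M) (Y : Set M) (N : ℕ) (z : ℕ → M) (s : ℕ → ℕ) : Set (ℕ × ℕ) :=
  {I | I.1 < N ∧ I.2 < N ∧
    {i : ℕ | z (s i) ∈ f^[I.1] '' Y ∧ (N : ℤ) ∣ (s i : ℤ) - (I.2 : ℤ)}.Infinite}

/-- `Ind'(𝓩, S, Y)`: the set of the integers `I₁ - I₂` with `(I₁, I₂) ∈ Ind(𝓩, S, Y)`. -/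
def indexDiffSet (f : M → M) (Y : Set M) (N : ℕ) (z : ℕ → M) (s : ℕ → ℕ) : Set ℤ :=
  (fun I : ℕ × ℕ => (I.1 : ℤ) - (I.2 : ℤ)) '' indexSet f Y N z s

end Dynamics

/-- `-ln φ(n) / n` for `φ : ℕ → (0, 1]`, a nonnegative number. -/
noncomputable def decayRate (φ : ℕ → ℝ) (n : ℕ) : ℝ≥0∞ :=
  ENNReal.ofReal (-Real.log (φ n) / n)

/-- The supremum over `j` of `limsup_n -ln φ_j(n) / n`. -/
noncomputable def upperTau (φ : ℕ → ℕ → ℝ) : ℝ≥0∞ :=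
  ⨆ j, limsup (decayRate (φ j)) atTop

/-- The supremum over `j` of `liminf_n -ln φ_j(n) / n`. -/
noncomputable def lowerTau (φ : ℕ → ℕ → ℝ) : ℝ≥0∞ :=
  ⨆ j, liminf (decayRate (φ j)) atTop

/-! ### Two-sided symbolic dynamics -/

/-- The two-sided full symbolic space over the alphabet `A`. It is a type synonym, carrying the
metric `d(x, y) = exp (- min {|k| : x_k ≠ y_k})`, which induces the product topology. -/
def TwoSided (A : Type*) : Type _ := ℤ → A

namespace TwoSided

variable {A : Type*}

/-- `min {|k| : x_k ≠ y_k}`, meaningful for `x ≠ y`. -/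
noncomputable def firstDiff (x y : TwoSided A) : ℕ :=
  sInf {m : ℕ | ∃ k : ℤ, k.natAbs = m ∧ x k ≠ y k}

open Classical in
/-- The distance on the two-sided full symbolic space. -/
noncomputable def symDist (x y : TwoSided A) : ℝ :=
  if x = y then 0 else Real.exp (-(firstDiff x y : ℝ))

theorem symDist_comm (x y : TwoSided A) : symDist x y = symDist y x := by
  have h : firstDiff x y = firstDiff y x := by
    unfold firstDiff
    simp only [ne_comm]
  unfold symDist
  rw [h]
  by_cases hxy : x = y
  · rw [if_pos hxy, if_pos hxy.symm]
  · rw [if_neg hxy, if_neg (Ne.symm hxy)]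

theorem symDist_nonneg (x y : TwoSided A) : 0 ≤ symDist x y := by
  unfold symDist
  split_ifs
  · exact le_rfl
  · exact (Real.exp_pos _).le

theorem symDist_le_max (x y z : TwoSided A) :
    symDist x z ≤ max (symDist x y) (symDist y z) := by
  by_cases hxz : x = z
  · have h : symDist x z = 0 := if_pos hxz
    rw [h]
    exact le_max_of_le_left (symDist_nonneg x y)
  by_cases hxy : x = y
  · subst hxy
    exact le_max_right _ _
  by_cases hyz : y = z
  · subst hyz
    exact le_max_left _ _
  have e1 : symDist x z = Real.exp (-(firstDiff x z : ℝ)) := if_neg hxz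
  have e2 : symDist x y = Real.exp (-(firstDiff x y : ℝ)) := if_neg hxy
  have e3 : symDist y z = Real.exp (-(firstDiff y z : ℝ)) := if_neg hyz
  have hne : {m : ℕ | ∃ k : ℤ, k.natAbs = m ∧ x k ≠ z k}.Nonempty := by
    obtain ⟨k, hk⟩ := Function.ne_iff.mp hxz
    exact ⟨k.natAbs, k, rfl, hk⟩
  obtain ⟨k, hk, hkne⟩ := Nat.sInf_mem hne
  have hk' : k.natAbs = firstDiff x z := hk
  rw [e1, e2, e3]
  by_cases h : x k = y k
  · have h2 : y k ≠ z k := fun h' => hkne (h.trans h')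
    have h3 : firstDiff y z ≤ firstDiff x z := hk' ▸ Nat.sInf_le ⟨k, rfl, h2⟩
    apply le_max_of_le_right
    gcongr
  · have h3 : firstDiff x y ≤ firstDiff x z := hk' ▸ Nat.sInf_le ⟨k, rfl, h⟩
    apply le_max_of_le_left
    gcongr

noncomputable instance : MetricSpace (TwoSided A) where
  dist := symDist
  dist_self x := if_pos rfl
  dist_comm := symDist_comm
  dist_triangle x y z := (symDist_le_max x y z).trans
    (max_le_add_of_nonneg (symDist_nonneg x y) (symDist_nonneg y z))
  eq_of_dist_eq_zero {x y} h := by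
    by_contra hxy
    have e : symDist x y = Real.exp (-(firstDiff x y : ℝ)) := if_neg hxy
    exact (Real.exp_pos _).ne' (e.symm.trans h)

/-- The shift `(σ x)_n = x_{n+1}`. -/
def shift (x : TwoSided A) : TwoSided A := fun n => x (n + 1)

/-- A two-sided subshift: a closed shift-invariant subset of the full symbolic space. -/
def IsSubshift (X : Set (TwoSided A)) : Prop :=
  IsClosed X ∧ shift '' X = X

end TwoSided

end ShrinkingTarget

/-! Let `u` be the growth rate of the words of `X`, which is its entropy. Hitting a target of radius
about `exp (-t n)` at time `n` means having prescribed coordinates on `[n - tn, n + tn]`.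

Upper bounds. If `t` is below the lower rate of some index `j`, every point of `W` hits such targets
for infinitely many `n`. For `t ≤ 1`, a point that hits at time `n` is known on `[0, n + tn]` once
it is known on `[0, n - tn)`, so about `exp (u (1 - t) n)` dynamical balls of length `(1 + t) n`
suffice; this gives the exponent `u (1 - t) / (1 + t)` (`bowenEntropy_le_of_hits`). For the metric
the window is `[-(n + tn), n + tn]`, of which `2n` coordinates are undetermined; this gives `2u / (1
+ t)` (`dimH_le_of_hits`). For `t > 1` the prescribed window surrounds the coordinate `0`, and one
set of diameter `exp (-(t - 1) n)` suffices for each `n` (`dimH_eq_zero_of_hits`).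

Lower bounds. Specification and compactness allow infinitely many words to be glued in both
directions with sublinear gaps (`exists_gluing`). Targets of all indices are prescribed at very
sparse times `n`, blocking about `[(1 - t) n, (1 + t) n]`; everywhere else words of a fixed length
are chosen freely. The free part of `[0, J)` then has proportion at least `c`, for any `c < (1 - t)
/ (1 + t)`, and all negative cells are free. Under the uniform product measure on the choices,
agreement on `[0, n)` has mass about `exp (-c u n)`, and agreement on `|k| < m` about `exp (-(1 + c)
u m)` (`exists_mass`). The mass distribution principle concludes, since `1 + (1 - t) / (1 + t) = 2 /
(1 + t)`.

Arithmetic. Gluing takes place in `Y` on multiples of `N`, and the points built are `σ^a y` with `y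
∈ Y`. The target of time `n` is usable if `σ^(-(n + a)) z_n ∈ Y`; a common element of the sets
`Ind'_j` gives one `a` that works infinitely often for every `j`. These times may miss those at
which the radius is large, hence the limsup in the lower bounds. If all positive times are usable,
the liminf suffices and the bounds meet. -/

namespace ShrinkingTarget

/-! ### Coordinates -/

namespace TwoSided

variable {A : Type*}

theorem dist_eq_exp {x y : TwoSided A} (hxy : x ≠ y) :
    dist x y = Real.exp (-(firstDiff x y : ℝ)) := if_neg hxy

theorem le_firstDiff_iff {x y : TwoSided A} (hxy : x ≠ y) (m : ℕ) :
    m ≤ firstDiff x y ↔ ∀ k : ℤ, k.natAbs < m → x k = y k := by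
  have hne : {m : ℕ | ∃ k : ℤ, k.natAbs = m ∧ x k ≠ y k}.Nonempty := by
    obtain ⟨k, hk⟩ := Function.ne_iff.mp hxy
    exact ⟨k.natAbs, k, rfl, hk⟩
  constructor
  · intro h k hk
    by_contra hne'
    have : firstDiff x y ≤ k.natAbs := Nat.sInf_le ⟨k, rfl, hne'⟩
    omega
  · intro h
    obtain ⟨k, hk, hkne⟩ := Nat.sInf_mem hne
    have hk' : k.natAbs = firstDiff x y := hk
    by_contra hlt
    exact hkne (h k (by omega))

theorem dist_le_exp_iff (x y : TwoSided A) (m : ℕ) :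
    dist x y ≤ Real.exp (-(m : ℝ)) ↔ ∀ k : ℤ, k.natAbs < m → x k = y k := by
  by_cases hxy : x = y
  · subst hxy
    simp [(Real.exp_pos _).le]
  · rw [dist_eq_exp hxy, Real.exp_le_exp, neg_le_neg_iff, Nat.cast_le, le_firstDiff_iff hxy]

theorem dist_lt_exp_iff (x y : TwoSided A) (m : ℕ) :
    dist x y < Real.exp (-(m : ℝ)) ↔ ∀ k : ℤ, k.natAbs ≤ m → x k = y k := by
  by_cases hxy : x = y
  · subst hxy
    simp [Real.exp_pos]
  · rw [dist_eq_exp hxy, Real.exp_lt_exp, neg_lt_neg_iff, Nat.cast_lt, ← Nat.succ_le_iff,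
      le_firstDiff_iff hxy]
    simp only [Nat.lt_succ_iff]

theorem dist_lt_one_iff (x y : TwoSided A) : dist x y < 1 ↔ x 0 = y 0 := by
  have := dist_lt_exp_iff x y 0
  simp only [Nat.cast_zero, neg_zero, Real.exp_zero, Nat.le_zero, Int.natAbs_eq_zero,
    forall_eq] at this
  exact this

/-- The translate of a sequence by `a` places to the left; `shift` is the case `a = 1`. -/
def translate (a : ℤ) (x : TwoSided A) : TwoSided A := fun k => x (k + a)

@[simp] theorem translate_apply (a : ℤ) (x : TwoSided A) (k : ℤ) :
    translate a x k = x (k + a) := rfl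

theorem shift_iterate (n : ℕ) (x : TwoSided A) : shift^[n] x = translate n x := by
  induction n generalizing x with
  | zero => funext k; simp
  | succ n ih =>
    rw [Function.iterate_succ_apply, ih]
    funext k
    simp only [translate_apply, shift]
    congr 1
    push_cast
    ring

@[simp] theorem shift_iterate_apply (n : ℕ) (x : TwoSided A) (k : ℤ) :
    (shift^[n] x) k = x (k + n) := by
  rw [shift_iterate, translate_apply]

theorem translate_translate (a b : ℤ) (x : TwoSided A) :
    translate a (translate b x) = translate (a + b) x := by
  funext k
  simp [add_assoc]

@[simp] theorem translate_zero (x : TwoSided A) : translate 0 x = x := by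
  funext k
  simp

/-- If a power of the shift maps `Y` onto itself, then so do all the multiples of it. -/
theorem translate_mem {Y : Set (TwoSided A)} {N : ℕ} (h : shift^[N] '' Y = Y)
    (a : ℤ) {y : TwoSided A} (hy : y ∈ Y) : translate (N * a) y ∈ Y := by
  have h1 : ∀ y ∈ Y, translate N y ∈ Y := fun y hy => by
    rw [← shift_iterate, ← h]
    exact mem_image_of_mem _ hy
  have h2 : ∀ y ∈ Y, translate (-N) y ∈ Y := fun y hy => by
    rw [← h] at hy
    obtain ⟨w, hw, rfl⟩ := hy
    rw [shift_iterate, translate_translate]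
    simpa using hw
  induction a using Int.induction_on with
  | zero => simpa using hy
  | succ i ih =>
    have := h1 _ ih
    rw [translate_translate] at this
    convert this using 2
    ring
  | pred i ih =>
    have := h2 _ ih
    rw [translate_translate] at this
    convert this using 2
    ring

theorem IsSubshift.translate_mem {X : Set (TwoSided A)} (hX : IsSubshift X) (a : ℤ)
    {x : TwoSided A} (hx : x ∈ X) : translate a x ∈ X := by
  have := TwoSided.translate_mem (N := 1) (by simpa using hX.2) a hx
  simpa using this

/-! ### Words -/

/-- The word of length `n` that a sequence shows from the coordinate `a` on. -/
def wordAt (a : ℤ) (n : ℕ) (x : TwoSided A) : Fin n → A := fun i => x (a + (i : ℕ))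

theorem wordAt_eq_iff {a : ℤ} {n : ℕ} {x y : TwoSided A} :
    wordAt a n x = wordAt a n y ↔ ∀ k : ℤ, a ≤ k → k < a + n → x k = y k := by
  constructor
  · intro h k hk hk'
    have := congrFun h ⟨(k - a).toNat, by omega⟩
    simp only [wordAt] at this
    rwa [show a + ((k - a).toNat : ℤ) = k by omega] at this
  · intro h
    funext i
    exact h _ (by omega) (by omega)

/-- The number of words of length `n` that elements of `Z` show from the coordinate `a` on. -/
noncomputable def numWords (Z : Set (TwoSided A)) (a : ℤ) (n : ℕ) : ℕ := (wordAt a n '' Z).ncard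

theorem _root_.Set.ncard_image_le_of_factor {α β γ : Type*} {Z : Set α} {f : α → β} {g : α → γ}
    (h : ∀ x ∈ Z, ∀ y ∈ Z, g x = g y → f x = f y) (hg : (g '' Z).Finite) :
    (f '' Z).ncard ≤ (g '' Z).ncard := by
  classical
  rcases Z.eq_empty_or_nonempty with rfl | ⟨x₀, hx₀⟩
  · simp
  let F : γ → β := fun c => if hc : ∃ x ∈ Z, g x = c then f hc.choose else f x₀
  have hsub : f '' Z ⊆ F '' (g '' Z) := by
    rintro _ ⟨x, hx, rfl⟩
    refine ⟨g x, ⟨x, hx, rfl⟩, ?_⟩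
    have hc : ∃ y ∈ Z, g y = g x := ⟨x, hx, rfl⟩
    simp only [F, dif_pos hc]
    exact h _ hc.choose_spec.1 _ hx hc.choose_spec.2
  exact (Set.ncard_le_ncard hsub (hg.image F)).trans (Set.ncard_image_le hg)

theorem numWords_translate_eq {X : Set (TwoSided A)} (hX : IsSubshift X) (a : ℤ) (n : ℕ) :
    numWords X a n = numWords X 0 n := by
  unfold numWords
  congr 1
  ext w
  constructor
  · rintro ⟨x, hx, rfl⟩
    refine ⟨translate a x, hX.translate_mem a hx, ?_⟩
    funext i
    simp [wordAt, add_comm]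
  · rintro ⟨x, hx, rfl⟩
    refine ⟨translate (-a) x, hX.translate_mem _ hx, ?_⟩
    funext i
    simp [wordAt]

variable [Finite A]

theorem numWords_le_of_agree {Z : Set (TwoSided A)} {a b : ℤ} {n m : ℕ}
    (h : ∀ k : ℤ, a ≤ k → k < a + n → b ≤ k ∧ k < b + m) :
    numWords Z a n ≤ numWords Z b m := by
  refine Set.ncard_image_le_of_factor (fun x _ y _ hxy => ?_) (Set.toFinite _)
  rw [wordAt_eq_iff] at hxy ⊢
  exact fun k hk hk' => hxy k (h k hk hk').1 (h k hk hk').2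

theorem numWords_add_le (Z : Set (TwoSided A)) (a : ℤ) (m n : ℕ) :
    numWords Z a (m + n) ≤ numWords Z a m * numWords Z (a + m) n := by
  have h1 : numWords Z a (m + n) ≤
      ((fun x => (wordAt a m x, wordAt (a + m) n x)) '' Z).ncard := by
    refine Set.ncard_image_le_of_factor (fun x _ y _ hxy => ?_) (Set.toFinite _)
    rw [Prod.mk.injEq, wordAt_eq_iff, wordAt_eq_iff] at hxy
    rw [wordAt_eq_iff]
    intro k hk hk'
    push_cast at hk'
    by_cases hkm : k < a + m
    · exact hxy.1 k hk hkm
    · exact hxy.2 k (by omega) (by omega)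
  refine h1.trans ?_
  rw [numWords, numWords, ← Set.ncard_prod]
  refine Set.ncard_le_ncard ?_ (Set.toFinite _)
  rintro _ ⟨x, hx, rfl⟩
  exact ⟨⟨x, hx, rfl⟩, ⟨x, hx, rfl⟩⟩

theorem numWords_pos {Z : Set (TwoSided A)} (hZ : Z.Nonempty) (a : ℤ) (n : ℕ) :
    0 < numWords Z a n :=
  (Set.ncard_pos (Set.toFinite _)).2 (hZ.image _)

end TwoSided

namespace TwoSided

variable {A : Type*}

/-! ### Topological entropy of a subshift as a growth rate of words -/

theorem bddBelow_log_numWords (X : Set (TwoSided A)) :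
    BddBelow (range fun n : ℕ => Real.log (numWords X 0 n) / n) := by
  refine ⟨0, ?_⟩
  rintro _ ⟨n, rfl⟩
  have := Real.log_natCast_nonneg (numWords X 0 n)
  positivity

theorem exists_numWords_le_exp {X : Set (TwoSided A)} {u u' : ℝ} (huu : u < u')
    (hu : Tendsto (fun n : ℕ => Real.log (numWords X 0 n) / n) atTop (𝓝 u)) :
    ∃ C : ℝ, 0 < C ∧ ∀ n : ℕ, (numWords X 0 n : ℝ) ≤ C * Real.exp (u' * n) := by
  have h1 : ∀ᶠ n : ℕ in atTop, (numWords X 0 n : ℝ) ≤ Real.exp (u' * n) := by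
    filter_upwards [hu.eventually_lt_const huu, eventually_gt_atTop 0] with n hn hn0
    have hn' : (0 : ℝ) < n := by exact_mod_cast hn0
    rw [div_lt_iff₀ hn'] at hn
    rcases (Nat.cast_nonneg (α := ℝ) (numWords X 0 n)).eq_or_lt with h0 | h0
    · rw [← h0]
      positivity
    · exact ((Real.log_le_iff_le_exp h0).1 hn.le)
  obtain ⟨n₀, hn₀⟩ := eventually_atTop.1 h1
  refine ⟨1 + ∑ i ∈ Finset.range n₀, (numWords X 0 i : ℝ) / Real.exp (u' * i), by positivity,
    fun n => ?_⟩
  have hpos := Real.exp_pos (u' * n)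
  rcases lt_or_ge n n₀ with hn | hn
  · rw [← div_le_iff₀ hpos]
    have := Finset.single_le_sum (f := fun i : ℕ => (numWords X 0 i : ℝ) / Real.exp (u' * i))
      (fun i _ => by positivity) (Finset.mem_range.2 hn)
    linarith
  · refine (hn₀ n hn).trans (le_mul_of_one_le_left hpos.le ?_)
    have : 0 ≤ ∑ i ∈ Finset.range n₀, (numWords X 0 i : ℝ) / Real.exp (u' * i) := by positivity
    linarith

variable [Finite A]

theorem subadditive_log_numWords {X : Set (TwoSided A)} (hX : IsSubshift X) (hne : X.Nonempty) :
    Subadditive (fun n => Real.log (numWords X 0 n)) := by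
  intro m n
  have hp : ∀ k, (0 : ℝ) < numWords X 0 k := fun k => by exact_mod_cast numWords_pos hne 0 k
  rw [← Real.log_mul (hp m).ne' (hp n).ne']
  refine Real.log_le_log (hp _) ?_
  have := numWords_add_le X 0 m n
  rw [numWords_translate_eq hX (0 + m)] at this
  exact_mod_cast this

/-- Fekete's lemma: the limit is also the infimum, so the lower bound on the number of words has no
error term. -/
theorem exists_wordGrowth {X : Set (TwoSided A)} (hX : IsSubshift X) (hne : X.Nonempty) :
    ∃ u : ℝ, 0 ≤ u ∧ Tendsto (fun n : ℕ => Real.log (numWords X 0 n) / n) atTop (𝓝 u) ∧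
      ∀ n : ℕ, Real.exp (u * n) ≤ numWords X 0 n := by
  have hsub := subadditive_log_numWords hX hne
  have ht := hsub.tendsto_lim (bddBelow_log_numWords X)
  refine ⟨hsub.lim, ?_, ht, ?_⟩
  · refine ge_of_tendsto' ht fun n => ?_
    have := Real.log_natCast_nonneg (numWords X 0 n)
    positivity
  · intro n
    have hp : (0 : ℝ) < numWords X 0 n := by exact_mod_cast numWords_pos hne 0 n
    rcases Nat.eq_zero_or_pos n with rfl | hn
    · have : (1 : ℝ) ≤ numWords X 0 0 := by exact_mod_cast numWords_pos hne 0 0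
      simpa using this
    · have h1 := hsub.lim_le_div (bddBelow_log_numWords X) hn.ne'
      rw [← Real.le_log_iff_exp_le hp]
      have hn' : (0 : ℝ) < n := by exact_mod_cast hn
      rwa [le_div_iff₀ hn'] at h1

theorem exists_separated (X : Set (TwoSided A)) (n : ℕ) :
    ∃ E : Finset (TwoSided A), IsSeparatedIn shift X n (1 / 2) E ∧ E.card = numWords X 0 n := by
  classical
  obtain ⟨E, hEX, hE⟩ := Set.exists_subset_bijOn X (wordAt 0 n)
  have hfin : E.Finite := Set.Finite.of_finite_image
    (by rw [hE.image_eq]; exact Set.toFinite _) hE.injOn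
  refine ⟨hfin.toFinset, ⟨by simpa using hEX, ?_⟩, ?_⟩
  · intro x hx y hy hxy
    rw [hfin.mem_toFinset] at hx hy
    have hw : wordAt 0 n x ≠ wordAt 0 n y := fun h => hxy (hE.injOn hx hy h)
    rw [Ne, wordAt_eq_iff] at hw
    push Not at hw
    obtain ⟨k, hk, hk', hne⟩ := hw
    refine ⟨k.toNat, by omega, ?_⟩
    have h1 : ¬ dist (shift^[k.toNat] x) (shift^[k.toNat] y) < 1 := by
      rw [dist_lt_one_iff]
      simpa [Int.toNat_of_nonneg hk] using hne
    linarith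
  · rw [← Set.ncard_eq_toFinset_card E hfin, numWords, ← hE.image_eq,
      hE.injOn.ncard_image]

theorem card_le_of_separated {X : Set (TwoSided A)} {n m : ℕ} {ε : ℝ} {E : Finset (TwoSided A)}
    (hm : Real.exp (-(m : ℝ)) ≤ ε) (hE : IsSeparatedIn shift X n ε E) :
    E.card ≤ numWords X (-m) (n + 2 * m) := by
  rw [← Set.ncard_coe_finset E]
  refine Set.ncard_le_ncard_of_injOn (wordAt (-m) (n + 2 * m))
    (fun x hx => ⟨x, hE.1 hx, rfl⟩) ?_ (Set.toFinite _)
  intro x hx y hy hxy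
  by_contra hne
  obtain ⟨k, hk, hd⟩ := hE.2 x hx y hy hne
  have : dist (shift^[k] x) (shift^[k] y) ≤ Real.exp (-(m : ℝ)) := by
    rw [dist_le_exp_iff]
    intro i hi
    simp only [shift_iterate_apply]
    rw [wordAt_eq_iff] at hxy
    exact hxy _ (by omega) (by push_cast; omega)
  linarith

/-- The scale `1 / 2` already separates distinct words, while a scale `exp (-m)` only lengthens the
words by `2 * m`, which disappears in the limit. -/
theorem topEntropy_eq {X : Set (TwoSided A)} (hX : IsSubshift X) {u : ℝ}
    (hu : Tendsto (fun n : ℕ => Real.log (numWords X 0 n) / n) atTop (𝓝 u)) :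
    topEntropy shift X = ENNReal.ofReal u := by
  apply le_antisymm
  · refine iSup₂_le fun ε hε => ?_
    obtain ⟨m, hm⟩ : ∃ m : ℕ, Real.exp (-(m : ℝ)) ≤ ε := by
      obtain ⟨m, hm⟩ := exists_nat_ge (-Real.log ε)
      refine ⟨m, ?_⟩
      rw [← Real.le_log_iff_exp_le hε]
      linarith
    have hle : ∀ n : ℕ, separatedRate shift X ε n ≤
        ENNReal.ofReal (Real.log (numWords X 0 (n + 2 * m)) / n) := by
      intro n
      refine iSup₂_le fun E hE => ENNReal.ofReal_le_ofReal ?_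
      rcases E.card.eq_zero_or_pos with h0 | h0
      · rw [h0]
        have := Real.log_natCast_nonneg (numWords X 0 (n + 2 * m))
        simp only [Nat.cast_zero, Real.log_zero, zero_div]
        positivity
      · have := card_le_of_separated hm hE
        rw [numWords_translate_eq hX] at this
        have h0' : (0 : ℝ) < E.card := by exact_mod_cast h0
        gcongr
    have hlim : Tendsto (fun n : ℕ => Real.log (numWords X 0 (n + 2 * m)) / n) atTop (𝓝 u) := by
      have h1 : Tendsto (fun n : ℕ => Real.log (numWords X 0 (n + 2 * m)) /
          ((n + 2 * m : ℕ) : ℝ)) atTop (𝓝 u) := hu.comp (tendsto_add_atTop_nat (2 * m))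
      have h2 : Tendsto (fun n : ℕ => 1 + ((2 * m : ℕ) : ℝ) / (n : ℝ)) atTop (𝓝 (1 + 0)) :=
        tendsto_const_nhds.add (tendsto_const_div_atTop_nhds_zero_nat _)
      have h3 := h1.mul h2
      rw [add_zero, mul_one] at h3
      refine h3.congr' ?_
      filter_upwards [eventually_gt_atTop 0] with n hn
      have hn' : (0 : ℝ) < n := by exact_mod_cast hn
      push_cast
      field_simp
    calc limsup (fun n : ℕ => separatedRate shift X ε n) atTop
        ≤ limsup (fun n : ℕ =>
          ENNReal.ofReal (Real.log (numWords X 0 (n + 2 * m)) / n)) atTop :=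
          limsup_le_limsup (Eventually.of_forall hle)
      _ = ENNReal.ofReal u := (ENNReal.tendsto_ofReal hlim).limsup_eq
  · refine le_trans ?_ (le_iSup₂ (f := fun (ε : ℝ) (_ : 0 < ε) =>
      limsup (fun n : ℕ => separatedRate shift X ε n) atTop) (1 / 2) (by norm_num))
    rw [← (ENNReal.tendsto_ofReal hu).limsup_eq]
    refine limsup_le_limsup (Eventually.of_forall fun n => ?_)
    obtain ⟨E, hE, hcard⟩ := exists_separated X n
    beta_reduce
    rw [← hcard]
    exact le_iSup₂ (f := fun (E : Finset (TwoSided A)) (_ : IsSeparatedIn shift X n (1 / 2) E) =>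
      ENNReal.ofReal (Real.log (E.card : ℝ) / n)) E hE

end TwoSided

namespace TwoSided

variable {A : Type*}

/-! ### Upper bounds by covers -/

/-- The strict inequality leaves room for a rate `u' > u`, and the series is then dominated by a
geometric one. -/
theorem tsum_numWords_mul_exp_ne_top {X : Set (TwoSided A)} {u : ℝ} (hu0 : 0 ≤ u)
    (hu : Tendsto (fun n : ℕ => Real.log (numWords X 0 n) / n) atTop (𝓝 u))
    {l R : ℕ → ℕ} {s α β C : ℝ} (hs : 0 ≤ s) (hlt : u * α < s * β)
    (hl : ∀ n : ℕ, (l n : ℝ) ≤ α * n + C) (hR : ∀ n : ℕ, β * n - C ≤ R n) :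
    ∑' n : ℕ, (numWords X 0 (l n) : ℝ≥0∞) * ENNReal.ofReal (Real.exp (-s * R n)) ≠ ∞ := by
  obtain ⟨u', huu', hu'⟩ : ∃ u', u < u' ∧ u' * α < s * β := by
    have h1 : ∀ᶠ v in 𝓝[>] u, v * α < s * β :=
      (((continuous_id.mul continuous_const).tendsto u).eventually_lt_const hlt).filter_mono
        nhdsWithin_le_nhds
    obtain ⟨v, hv, hv'⟩ := (h1.and self_mem_nhdsWithin).exists
    exact ⟨v, hv', hv⟩
  obtain ⟨K, hK0, hK⟩ := exists_numWords_le_exp huu' hu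
  have hu'0 : 0 ≤ u' := hu0.trans huu'.le
  set q : ℝ := Real.exp (-(s * β - u' * α)) with hq
  have hq1 : q < 1 := by
    rw [hq, Real.exp_lt_one_iff]
    linarith
  have hterm : ∀ n : ℕ, (numWords X 0 (l n) : ℝ) * Real.exp (-s * R n) ≤
      K * Real.exp (u' * C + s * C) * q ^ n := by
    intro n
    calc (numWords X 0 (l n) : ℝ) * Real.exp (-s * R n)
        ≤ (K * Real.exp (u' * l n)) * Real.exp (-s * R n) := by gcongr; exact hK _
      _ = K * Real.exp (u' * l n - s * R n) := by
        rw [mul_assoc, ← Real.exp_add]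
        ring_nf
      _ ≤ K * Real.exp (u' * (α * n + C) - s * (β * n - C)) := by
        gcongr
        · exact hl n
        · exact hR n
      _ = K * Real.exp (u' * C + s * C) * q ^ n := by
        rw [hq, ← Real.exp_nat_mul, mul_assoc, ← Real.exp_add]
        ring_nf
  have hsum : Summable fun n : ℕ => K * Real.exp (u' * C + s * C) * q ^ n :=
    (summable_geometric_of_lt_one (Real.exp_pos _).le hq1).mul_left _
  refine ne_top_of_le_ne_top hsum.tsum_ofReal_ne_top (ENNReal.tsum_le_tsum fun n => ?_)
  rw [← ENNReal.ofReal_natCast, ← ENNReal.ofReal_mul (Nat.cast_nonneg _)]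
  exact ENNReal.ofReal_le_ofReal (hterm n)

variable [Finite A]

/-- A Borel–Cantelli argument: each tail of the series bounds the cost of a cover of `Z`. The ball
centres, one for each word, are taken in `T n` itself, so that they share its prescribed
coordinates. -/
theorem bowenOuter_eq_zero {X Z : Set (TwoSided A)} {T : ℕ → Set (TwoSided A)} {ε : ℝ} {s : ℝ≥0}
    {a : ℕ → ℤ} {l R : ℕ → ℕ} (hTX : ∀ n, T n ⊆ X) (hZ : Z ⊆ {x | ∃ᶠ n in atTop, x ∈ T n})
    (hball : ∀ n, ∀ x ∈ T n, ∀ y ∈ T n, wordAt (a n) (l n) x = wordAt (a n) (l n) y →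
      x ∈ dynBall shift X (R n) y ε)
    (hR : Tendsto R atTop atTop)
    (hsum : ∑' n : ℕ, (numWords X (a n) (l n) : ℝ≥0∞) *
      ENNReal.ofReal (Real.exp (-(s : ℝ) * R n)) ≠ ∞) :
    bowenOuter shift X Z ε s = 0 := by
  classical
  have hE : ∀ n, ∃ E : Finset (TwoSided A), (E : Set (TwoSided A)) ⊆ T n ∧
      (∀ x ∈ T n, ∃ y ∈ E, wordAt (a n) (l n) x = wordAt (a n) (l n) y) ∧
      E.card ≤ numWords X (a n) (l n) := by
    intro n
    obtain ⟨E, hET, hE⟩ := Set.exists_subset_bijOn (T n) (wordAt (a n) (l n))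
    have hfin : E.Finite := Set.Finite.of_finite_image
      (by rw [hE.image_eq]; exact Set.toFinite _) hE.injOn
    refine ⟨hfin.toFinset, by simpa using hET, ?_, ?_⟩
    · intro x hx
      obtain ⟨y, hy, hyx⟩ := hE.surjOn ⟨x, hx, rfl⟩
      exact ⟨y, hfin.mem_toFinset.2 hy, hyx.symm⟩
    · rw [← Set.ncard_eq_toFinset_card E hfin, ← hE.injOn.ncard_image, hE.image_eq]
      exact Set.ncard_le_ncard (image_mono (hTX n)) (Set.toFinite _)
  choose E hET hEw hEc using hE
  unfold bowenOuter
  rw [ENNReal.iSup_eq_zero]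
  intro L
  obtain ⟨n₀, hn₀⟩ := eventually_atTop.1 (hR.eventually_ge_atTop (L + 1))
  refine le_antisymm ?_ bot_le
  refine ge_of_tendsto (ENNReal.tendsto_sum_nat_add _ hsum) ?_
  filter_upwards [eventually_ge_atTop n₀] with K hK
  let F : ℕ → Finset (TwoSided A × ℕ) := fun n => (E (n + K)).image fun y => (y, R (n + K))
  let C : Set (TwoSided A × ℕ) := ⋃ n, (F n : Set (TwoSided A × ℕ))
  have hC : IsDynCover shift X Z (L + 1) ε C := by
    refine ⟨countable_iUnion fun n => (F n).countable_toSet, ?_, ?_⟩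
    · intro c hc
      obtain ⟨n, hn⟩ := mem_iUnion.1 hc
      obtain ⟨y, hy, rfl⟩ := Finset.mem_image.1 (Finset.mem_coe.1 hn)
      exact ⟨hTX _ (hET _ hy), hn₀ _ (by omega)⟩
    · intro x hx
      obtain ⟨n, hn, hxn⟩ := frequently_atTop.1 (hZ hx) K
      obtain ⟨y, hy, hxy⟩ := hEw n x hxn
      refine mem_iUnion₂.2 ⟨(y, R n), mem_iUnion.2 ⟨n - K, ?_⟩, ?_⟩
      · refine Finset.mem_coe.2 (Finset.mem_image.2 ⟨y, ?_, ?_⟩)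
        · rwa [Nat.sub_add_cancel hn]
        · rw [Nat.sub_add_cancel hn]
      · exact hball n x hxn y (hET n hy) hxy
  refine (iInf₂_le C hC).trans ?_
  refine (ENNReal.tsum_iUnion_le_tsum
    (fun c : TwoSided A × ℕ => ENNReal.ofReal (Real.exp (-(s : ℝ) * (c.2 : ℝ)))) _).trans ?_
  refine ENNReal.tsum_le_tsum fun n => ?_
  rw [Finset.tsum_subtype' (F n)
    (fun c : TwoSided A × ℕ => ENNReal.ofReal (Real.exp (-(s : ℝ) * (c.2 : ℝ))))]
  refine (Finset.sum_le_card_nsmul (F n) _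
    (ENNReal.ofReal (Real.exp (-(s : ℝ) * (R (n + K) : ℝ)))) ?_).trans ?_
  · intro c hc
    obtain ⟨y, hy, rfl⟩ := Finset.mem_image.1 hc
    exact le_rfl
  · rw [nsmul_eq_mul]
    gcongr
    exact Finset.card_image_le.trans (hEc _)

theorem dimH_le_of_limsup_cover {X Z : Set (TwoSided A)} {T : ℕ → Set (TwoSided A)} {s : ℝ≥0}
    {a : ℕ → ℤ} {l R : ℕ → ℕ} (hTX : ∀ n, T n ⊆ X) (hZ : Z ⊆ {x | ∃ᶠ n in atTop, x ∈ T n})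
    (hball : ∀ n, ∀ x ∈ T n, ∀ y ∈ T n, wordAt (a n) (l n) x = wordAt (a n) (l n) y →
      ∀ k : ℤ, k.natAbs < R n → x k = y k)
    (hR : Tendsto R atTop atTop)
    (hsum : ∑' n : ℕ, (numWords X (a n) (l n) : ℝ≥0∞) *
      ENNReal.ofReal (Real.exp (-(s : ℝ) * R n)) ≠ ∞) :
    dimH Z ≤ s := by
  borelize (TwoSided A)
  have hzero : MeasureTheory.Measure.hausdorffMeasure (s : ℝ) Z = 0 := by
    let ι : ℕ → Type _ := fun K => Σ n : ℕ, ↥(wordAt (a (n + K)) (l (n + K)) '' X)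
    let t : (K : ℕ) → ι K → Set (TwoSided A) := fun K i =>
      {x | x ∈ T (i.1 + K) ∧ wordAt (a (i.1 + K)) (l (i.1 + K)) x = i.2}
    have hdiam : ∀ K (i : ι K), Metric.ediam (t K i) ≤
        ENNReal.ofReal (Real.exp (-(R (i.1 + K) : ℝ))) := by
      intro K i
      refine Metric.ediam_le fun x hx y hy => ?_
      rw [edist_dist]
      refine ENNReal.ofReal_le_ofReal ((dist_le_exp_iff _ _ _).2 ?_)
      exact hball _ x hx.1 y hy.1 (hx.2.trans hy.2.symm)
    have hRr : Tendsto (fun n => ENNReal.ofReal (Real.exp (-(R n : ℝ)))) atTop (𝓝 0) := by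
      rw [← ENNReal.ofReal_zero]
      refine ENNReal.tendsto_ofReal (Real.tendsto_exp_neg_atTop_nhds_zero.comp ?_)
      exact tendsto_natCast_atTop_atTop.comp hR
    -- `R` need not be monotone, so the mesh of the `K`-th cover is bounded by a supremum over the
    -- tail.
    let r : ℕ → ℝ≥0∞ := fun K => ⨆ n ≥ K, ENNReal.ofReal (Real.exp (-(R n : ℝ)))
    have hr : Tendsto r atTop (𝓝 0) := by
      rw [ENNReal.tendsto_nhds_zero]
      intro ε hε
      obtain ⟨n₀, hn₀⟩ := eventually_atTop.1 ((ENNReal.tendsto_nhds_zero.1 hRr) ε hε)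
      filter_upwards [eventually_ge_atTop n₀] with K hK
      exact iSup₂_le fun n hn => hn₀ n (hK.trans hn)
    have hle := MeasureTheory.Measure.hausdorffMeasure_le_liminf_tsum (s : ℝ) Z r hr t
      (Eventually.of_forall fun K i => (hdiam K i).trans
        (le_iSup₂ (f := fun n (_ : n ≥ K) => ENNReal.ofReal (Real.exp (-(R n : ℝ))))
          (i.1 + K) (by omega)))
      (Eventually.of_forall fun K x hx => by
        obtain ⟨n, hn, hxn⟩ := frequently_atTop.1 (hZ hx) K
        obtain ⟨n, rfl⟩ := Nat.exists_eq_add_of_le' hn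
        exact mem_iUnion.2 ⟨⟨n, ⟨_, ⟨x, hTX _ hxn, rfl⟩⟩⟩, hxn, rfl⟩)
    have hbound : ∀ K, ∑' i : ι K, Metric.ediam (t K i) ^ (s : ℝ) ≤
        ∑' n : ℕ, (numWords X (a (n + K)) (l (n + K)) : ℝ≥0∞) *
          ENNReal.ofReal (Real.exp (-(s : ℝ) * R (n + K))) := by
      intro K
      rw [ENNReal.tsum_sigma']
      refine ENNReal.tsum_le_tsum fun n => ?_
      have : Fintype ↥(wordAt (a (n + K)) (l (n + K)) '' X) := Fintype.ofFinite _
      rw [tsum_fintype]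
      refine (Finset.sum_le_card_nsmul _ _
        (ENNReal.ofReal (Real.exp (-(s : ℝ) * (R (n + K) : ℝ)))) ?_).trans ?_
      · intro w _
        refine (ENNReal.rpow_le_rpow (hdiam K ⟨n, w⟩) s.2).trans ?_
        rw [ENNReal.ofReal_rpow_of_pos (Real.exp_pos _), ← Real.exp_mul]
        apply le_of_eq
        congr 2
        simp only [NNReal.val_eq_coe]
        ring
      · rw [nsmul_eq_mul, Finset.card_univ, ← Nat.card_eq_fintype_card,
          Nat.card_coe_set_eq, numWords]
    refine le_antisymm (hle.trans ?_) bot_le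
    rw [← (ENNReal.tendsto_sum_nat_add _ hsum).liminf_eq]
    exact liminf_le_liminf (Eventually.of_forall hbound)
  by_contra hlt
  rw [not_le] at hlt
  have := hausdorffMeasure_of_lt_dimH hlt
  rw [hzero] at this
  exact ENNReal.zero_ne_top this

end TwoSided

/-! ### Upper bounds for points that hit targets infinitely often -/

namespace TwoSided

variable {A : Type*}

/-- The points of `X` whose `n`-th iterate agrees with `z n` on the coordinates `|k| ≤ ρ n`. -/
def hitSet (X : Set (TwoSided A)) (z : ℕ → TwoSided A) (ρ : ℕ → ℕ) (n : ℕ) :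
    Set (TwoSided A) :=
  {x | x ∈ X ∧ ∀ k : ℤ, k.natAbs ≤ ρ n → x (k + n) = z n k}

theorem shrinkingTargetSet_subset {X : Set (TwoSided A)} {φ : ℕ → ℝ} {z : ℕ → TwoSided A}
    {S : Set ℕ} {ρ : ℕ → ℕ} (h : ∀ᶠ n in atTop, φ n ≤ Real.exp (-(ρ n : ℝ))) :
    shrinkingTargetSet shift X φ z S ⊆ {x | ∃ᶠ n in atTop, x ∈ hitSet X z ρ n} := by
  rintro x ⟨hx, hinf⟩
  refine ((Nat.frequently_atTop_iff_infinite.2 hinf).and_eventually h).mono ?_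
  rintro n ⟨⟨-, hn⟩, hφ⟩
  refine ⟨hx, fun k hk => ?_⟩
  have := (dist_lt_exp_iff _ _ _).1 (hn.trans_le hφ) k hk
  simpa using this

/-- The value `t = 0` is kept apart because it remains available when the liminf is `0`: there `φ n
≤ 1` suffices. -/
theorem eventually_le_exp_floor {φ : ℕ → ℝ} (hφ : ∀ n, 0 < φ n ∧ φ n ≤ 1) {t : ℝ} (ht0 : 0 ≤ t)
    (ht : t = 0 ∨ ENNReal.ofReal t < liminf (decayRate φ) atTop) :
    ∀ᶠ n : ℕ in atTop, φ n ≤ Real.exp (-((⌊t * n⌋₊ : ℕ) : ℝ)) := by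
  rcases ht with rfl | ht
  · refine Eventually.of_forall fun n => ?_
    simpa using (hφ n).2
  · filter_upwards [eventually_lt_of_lt_liminf ht, eventually_gt_atTop 0] with n hn hn0
    have hn' : (0 : ℝ) < n := by exact_mod_cast hn0
    unfold decayRate at hn
    rw [ENNReal.ofReal_lt_ofReal_iff_of_nonneg ht0, lt_div_iff₀ hn'] at hn
    rw [← Real.log_le_iff_le_exp (hφ n).1]
    have := Nat.floor_le (a := t * n) (by positivity)
    linarith

variable [Finite A]

theorem bowenEntropy_le_of_hits {X Z : Set (TwoSided A)} (hX : IsSubshift X) {u : ℝ} (hu0 : 0 ≤ u)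
    (hu : Tendsto (fun n : ℕ => Real.log (numWords X 0 n) / n) atTop (𝓝 u))
    {z : ℕ → TwoSided A} {t : ℝ} (ht0 : 0 ≤ t) (ht1 : t ≤ 1)
    (hZ : Z ⊆ {x | ∃ᶠ n in atTop, x ∈ hitSet X z (fun n => ⌊t * n⌋₊) n}) :
    bowenEntropy shift X Z ≤ ENNReal.ofReal ((1 - t) / (1 + t) * u) := by
  refine iSup₂_le fun ε hε => ?_
  refine le_of_forall_gt_imp_ge_of_dense fun s' hs' => ?_
  rcases eq_or_ne s' ∞ with rfl | hs'top
  · exact le_top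
  lift s' to ℝ≥0 using hs'top with s
  obtain ⟨m, hm⟩ : ∃ m : ℕ, Real.exp (-(m : ℝ)) ≤ ε := by
    obtain ⟨m, hm⟩ := exists_nat_ge (-Real.log ε)
    refine ⟨m, ?_⟩
    rw [← Real.le_log_iff_exp_le hε]
    linarith
  have hs : (1 - t) / (1 + t) * u < s := by
    rw [← ENNReal.ofReal_coe_nnreal] at hs'
    exact (ENNReal.ofReal_lt_ofReal_iff_of_nonneg
      (mul_nonneg (div_nonneg (by linarith) (by linarith)) hu0)).1 hs'
  have hs2 : u * (1 - t) < s * (1 + t) := by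
    have h1 : 0 < 1 + t := by linarith
    have h2 := mul_lt_mul_of_pos_right hs h1
    have h3 : (1 - t) / (1 + t) * u * (1 + t) = u * (1 - t) := by field_simp
    linarith
  have hfl : ∀ n : ℕ, (⌊t * n⌋₊ : ℝ) ≤ t * n := fun n => Nat.floor_le (by positivity)
  have hfl' : ∀ n : ℕ, t * n - 1 ≤ (⌊t * n⌋₊ : ℝ) := fun n => (Nat.sub_one_lt_floor _).le
  have hρn : ∀ n : ℕ, ⌊t * n⌋₊ ≤ n := fun n => by
    have h1 := hfl n
    have h2 : t * n ≤ 1 * n := by gcongr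
    have : (⌊t * n⌋₊ : ℝ) ≤ n := by linarith
    exact_mod_cast this
  have hRle : ∀ n : ℕ, (1 + t) * n - (m + 1 : ℝ) ≤ ((n + ⌊t * n⌋₊ + 1 - m : ℕ) : ℝ) := by
    intro n
    have h1 : (n : ℝ) + ⌊t * n⌋₊ + 1 ≤ ((n + ⌊t * n⌋₊ + 1 - m : ℕ) : ℝ) + m := by
      exact_mod_cast (by omega : n + ⌊t * n⌋₊ + 1 ≤ (n + ⌊t * n⌋₊ + 1 - m) + m)
    have := hfl' n
    linarith
  -- The scale `exp (-m)` reads `m` more coordinates on either side: on the left they lengthen the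
  -- word, on the right they shorten the ball.
  refine iInf₂_le s (bowenOuter_eq_zero (T := hitSet X z fun n => ⌊t * n⌋₊) (a := fun _ => -m)
    (l := fun n => n - ⌊t * n⌋₊ + m) (R := fun n => n + ⌊t * n⌋₊ + 1 - m)
    (fun n x hx => hx.1) hZ ?_ ?_ ?_)
  · intro n x hx y hy hxy
    refine ⟨hx.1, fun i hi => ?_⟩
    refine lt_of_lt_of_le ((dist_lt_exp_iff _ _ m).2 fun k hk => ?_) hm
    simp only [shift_iterate_apply]
    rw [wordAt_eq_iff] at hxy
    have := hρn n
    by_cases hlt : k + i < n - ⌊t * n⌋₊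
    · exact (hxy (k + i) (by omega) (by push_cast [Nat.cast_sub this]; omega)).symm
    · have h1 := hx.2 (k + i - n) (by beta_reduce; omega)
      have h2 := hy.2 (k + i - n) (by beta_reduce; omega)
      rw [sub_add_cancel] at h1 h2
      rw [h1, h2]
  · refine tendsto_atTop_mono (f := fun n => n - m) (fun n => by omega) (tendsto_sub_atTop_nat m)
  · simp only [numWords_translate_eq hX]
    refine tsum_numWords_mul_exp_ne_top hu0 hu (C := m + 1) s.2 hs2 (fun n => ?_) hRle
    have := hfl' n
    push_cast [Nat.cast_sub (hρn n)]
    linarith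

theorem dimH_le_of_hits {X Z : Set (TwoSided A)} (hX : IsSubshift X) {u : ℝ} (hu0 : 0 ≤ u)
    (hu : Tendsto (fun n : ℕ => Real.log (numWords X 0 n) / n) atTop (𝓝 u))
    {z : ℕ → TwoSided A} {t : ℝ} (ht0 : 0 ≤ t)
    (hZ : Z ⊆ {x | ∃ᶠ n in atTop, x ∈ hitSet X z (fun n => ⌊t * n⌋₊) n}) :
    dimH Z ≤ ENNReal.ofReal (2 / (1 + t) * u) := by
  refine le_of_forall_gt_imp_ge_of_dense fun s' hs' => ?_
  rcases eq_or_ne s' ∞ with rfl | hs'top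
  · exact le_top
  lift s' to ℝ≥0 using hs'top with s
  have hs : 2 / (1 + t) * u < s := by
    rw [← ENNReal.ofReal_coe_nnreal] at hs'
    exact (ENNReal.ofReal_lt_ofReal_iff_of_nonneg (by positivity)).1 hs'
  have hs2 : u * 2 < s * (1 + t) := by
    have h1 : 0 < 1 + t := by linarith
    have h2 := mul_lt_mul_of_pos_right hs h1
    have h3 : 2 / (1 + t) * u * (1 + t) = u * 2 := by field_simp
    linarith
  have hfl' : ∀ n : ℕ, t * n - 1 ≤ (⌊t * n⌋₊ : ℝ) := fun n => (Nat.sub_one_lt_floor _).le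
  -- The word fills `[-(n + tn), n - tn)`, whose length is `2 * n`; the target supplies the
  -- coordinates up to `n + tn`.
  refine dimH_le_of_limsup_cover (T := hitSet X z fun n => ⌊t * n⌋₊)
    (a := fun n => -(n + ⌊t * n⌋₊ : ℕ))
    (l := fun n => 2 * n) (R := fun n => n + ⌊t * n⌋₊ + 1)
    (fun n x hx => hx.1) hZ ?_ ?_ ?_
  · intro n x hx y hy hxy k hk
    rw [wordAt_eq_iff] at hxy
    by_cases hlt : k < n - ⌊t * n⌋₊
    · exact hxy k (by omega) (by push_cast; omega)
    · have h1 := hx.2 (k - n) (by beta_reduce; omega)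
      have h2 := hy.2 (k - n) (by beta_reduce; omega)
      rw [sub_add_cancel] at h1 h2
      rw [h1, h2]
  · exact tendsto_atTop_mono (f := fun n => n) (fun n => by omega) tendsto_id
  · simp only [numWords_translate_eq hX]
    refine tsum_numWords_mul_exp_ne_top hu0 hu (C := 1) s.2 hs2 (fun n => ?_) (fun n => ?_)
    · push_cast
      linarith
    · have := hfl' n
      push_cast
      linarith

/-- The target alone determines all coordinates `|k| < tn - n`, so the empty word indexes the cover.
-/
theorem dimH_eq_zero_of_hits {X Z : Set (TwoSided A)} {u : ℝ} (hu0 : 0 ≤ u)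
    (hu : Tendsto (fun n : ℕ => Real.log (numWords X 0 n) / n) atTop (𝓝 u))
    {z : ℕ → TwoSided A} {t : ℝ} (ht1 : 1 < t)
    (hZ : Z ⊆ {x | ∃ᶠ n in atTop, x ∈ hitSet X z (fun n => ⌊t * n⌋₊) n}) :
    dimH Z = 0 := by
  refine le_antisymm (le_of_forall_gt_imp_ge_of_dense fun s' hs' => ?_) bot_le
  rcases eq_or_ne s' ∞ with rfl | hs'top
  · exact le_top
  lift s' to ℝ≥0 using hs'top with s
  have hs : (0 : ℝ) < s := by exact_mod_cast hs'
  have hfl : ∀ n : ℕ, (t - 1) * n - 1 ≤ ((⌊t * n⌋₊ - n : ℕ) : ℝ) := by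
    intro n
    have h1 : (⌊t * n⌋₊ : ℝ) ≤ ((⌊t * n⌋₊ - n : ℕ) : ℝ) + n := by
      exact_mod_cast (by omega : ⌊t * n⌋₊ ≤ (⌊t * n⌋₊ - n) + n)
    have := (Nat.sub_one_lt_floor (t * n)).le
    linarith
  refine dimH_le_of_limsup_cover (T := hitSet X z fun n => ⌊t * n⌋₊) (a := fun n => 0)
    (l := fun n => 0) (R := fun n => ⌊t * n⌋₊ - n)
    (fun n x hx => hx.1) hZ ?_ ?_ ?_
  · intro n x hx y hy _ k hk
    have h1 := hx.2 (k - n) (by beta_reduce; omega)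
    have h2 := hy.2 (k - n) (by beta_reduce; omega)
    rw [sub_add_cancel] at h1 h2
    rw [h1, h2]
  · rw [← tendsto_natCast_atTop_iff (R := ℝ)]
    refine tendsto_atTop_mono hfl (tendsto_atTop_add_const_right _ _ ?_)
    exact tendsto_natCast_atTop_atTop.const_mul_atTop (by linarith)
  · refine tsum_numWords_mul_exp_ne_top (α := 0) (β := t - 1) hu0 hu (C := 1) s.2 ?_
      (fun n => ?_) hfl
    · rw [mul_zero]
      exact mul_pos hs (by linarith)
    · simp

end TwoSided

namespace TwoSided

variable {A : Type*}

/-! ### Gluing words -/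

theorem isClosed_coord_eq (k : ℤ) (c : A) : IsClosed {x : TwoSided A | x k = c} := by
  rw [← isOpen_compl_iff, Metric.isOpen_iff]
  intro x hx
  refine ⟨Real.exp (-(k.natAbs : ℝ)), Real.exp_pos _, fun y hy hyc => hx ?_⟩
  have := (dist_lt_exp_iff _ _ _).1 (Metric.mem_ball.1 hy) k le_rfl
  exact this.symm.trans hyc

/-- Words of lengths `N * ℓ u` placed at the positions `N * u`, for `u` in a finite set, with gaps
that are at least `N * p (ℓ u)`, can be glued to a point of `Y`. -/
theorem exists_glue_finset {Y : Set (TwoSided A)} {N : ℕ} (hN : 0 < N) (hYne : Y.Nonempty)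
    (hYN : shift^[N] '' Y = Y) {p : ℕ → ℕ}
    (hp : ∀ (k : ℕ) (x : ℕ → TwoSided A) (n q : ℕ → ℕ), 1 ≤ k →
      (∀ i < k, x i ∈ Y ∧ 1 ≤ n i ∧ p (n i) ≤ q i) →
      ∃ z ∈ Y, ∀ i < k, (shift^[N])^[∑ l ∈ Finset.range i, (n l + q l)] z ∈
        dynBall shift^[N] Y (n i) (x i) (Real.exp (-(N : ℝ))))
    (D : Finset ℤ) (ℓ : ℤ → ℕ) (y : ℤ → TwoSided A) (hy : ∀ v ∈ D, y v ∈ Y ∧ 1 ≤ ℓ v)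
    (hD : ∀ v ∈ D, ∀ w ∈ D, v < w → v + ℓ v + p (ℓ v) ≤ w) :
    ∃ z ∈ Y, ∀ v ∈ D, ∀ i : ℤ, N * v ≤ i → i < N * (v + ℓ v) → z i = y v i := by
  rcases D.eq_empty_or_nonempty with rfl | hDne
  · obtain ⟨z, hz⟩ := hYne
    exact ⟨z, hz, by simp⟩
  set K := D.card with hK
  have hK0 : 0 < K := hDne.card_pos
  let e : Fin K ↪o ℤ := D.orderEmbOfFin rfl
  let pos : ℕ → ℤ := fun i => if h : i < K then e ⟨i, h⟩ else 0
  have hpos : ∀ i < K, pos i ∈ D := fun i hi => by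
    simp only [pos, dif_pos hi]
    exact D.orderEmbOfFin_mem rfl _
  have hmono : ∀ i, i + 1 < K → pos i < pos (i + 1) := fun i hi => by
    simp only [pos, dif_pos hi, dif_pos (Nat.lt_of_succ_lt hi)]
    exact e.strictMono (by simp)
  let n : ℕ → ℕ := fun i => ℓ (pos i)
  -- The gaps are dictated by the positions; the last one is followed by nothing and receives the
  -- least admissible value.
  let q : ℕ → ℕ := fun i =>
    if i + 1 < K then (pos (i + 1) - pos i - ℓ (pos i)).toNat else p (ℓ (pos i))
  have hgap : ∀ i, i + 1 < K → pos i + ℓ (pos i) + p (ℓ (pos i)) ≤ pos (i + 1) := fun i hi =>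
    hD _ (hpos _ (by omega)) _ (hpos _ hi) (hmono i hi)
  have hsum : ∀ i < K, ((∑ l ∈ Finset.range i, (n l + q l) : ℕ) : ℤ) = pos i - pos 0 := by
    intro i
    induction i with
    | zero => simp
    | succ i ih =>
      intro hi
      have h1 := hgap i hi
      have h2 : ((n i + q i : ℕ) : ℤ) = pos (i + 1) - pos i := by
        simp only [n, q, if_pos hi]
        push_cast
        omega
      rw [Finset.sum_range_succ, Nat.cast_add, ih (by omega), h2]
      ring
  obtain ⟨z, hz, hzi⟩ := hp K (fun i => translate (N * pos i) (y (pos i))) n q hK0 (by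
    intro i hi
    refine ⟨translate_mem hYN _ (hy _ (hpos i hi)).1, (hy _ (hpos i hi)).2, ?_⟩
    by_cases hi' : i + 1 < K
    · have := hgap i hi'
      simp only [n, q, if_pos hi']
      omega
    · simp only [n, q, if_neg hi']
      exact le_rfl)
  -- Specification starts tracking at time `0`, whereas the first position is an arbitrary integer,
  -- possibly negative.
  refine ⟨translate (N * -pos 0) z, translate_mem hYN _ hz, fun v hv i hi hi' => ?_⟩
  obtain ⟨j, hj⟩ : ∃ j, e j = v := by
    have : v ∈ Set.range e := by
      rw [Finset.range_orderEmbOfFin]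
      exact hv
    exact this
  have hjv : pos j = v := by
    simp only [pos, dif_pos j.2]
    exact hj
  have hN' : (0 : ℤ) < N := by exact_mod_cast hN
  -- The coordinate is reached after `t` steps of `shift^[N]`, at the offset `r < N`. Closeness
  -- below `exp (-N)` fixes all coordinates `|k| ≤ N`, so one tracked step covers a whole block.
  set r : ℤ := (i - N * v) % N with hr
  have hr0 : 0 ≤ r := Int.emod_nonneg _ hN'.ne'
  have hrN : r < N := Int.emod_lt_of_pos _ hN'
  obtain ⟨t, ht⟩ : ∃ t : ℕ, (t : ℤ) = (i - N * v) / N :=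
    ⟨((i - N * v) / N).toNat, Int.toNat_of_nonneg (Int.ediv_nonneg (by linarith) hN'.le)⟩
  have hdiv : r + N * t = i - N * v := by
    rw [ht]
    exact Int.emod_add_mul_ediv _ _
  have htl : t < n j := by
    have h1 : (N : ℤ) * t < N * ℓ v := by nlinarith
    have h2 := lt_of_mul_lt_mul_left h1 hN'.le
    simp only [n, hjv]
    exact_mod_cast h2
  have h1 := (hzi j j.2).2 t htl
  rw [dist_lt_exp_iff] at h1
  have h2 := h1 r (by omega)
  rw [← Function.iterate_mul, ← Function.iterate_mul] at h2
  simp only [shift_iterate_apply, translate_apply, hjv] at h2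
  push_cast at h2
  have h3 := hsum j j.2
  push_cast at h3
  rw [h3, hjv] at h2
  rw [translate_apply]
  rw [show i + N * -pos 0 = r + N * t + N * (v - pos 0) by rw [hdiv]; ring, ← h2]
  congr 1
  linarith

/-- The gluing property that the specification property provides: words of lengths `N * ℓ i` can be
placed at the positions `N * pos i` if each is followed by a gap of length `N * p (ℓ i)` at least. -/
def Gluing (Y : Set (TwoSided A)) (N : ℕ) (p : ℕ → ℕ) : Prop :=
  ∀ {ι : Type} (pos : ι → ℤ) (ℓ : ι → ℕ) (y : ι → TwoSided A),
    (∀ i, y i ∈ Y ∧ 1 ≤ ℓ i) →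
    (∀ i j, i ≠ j → pos i + ℓ i + p (ℓ i) ≤ pos j ∨ pos j + ℓ j + p (ℓ j) ≤ pos i) →
    ∃ z ∈ Y, ∀ i, ∀ k : ℤ, N * pos i ≤ k → k < N * (pos i + ℓ i) → z k = y i k

/-- Each coordinate condition is closed, so by compactness of `Y` finitely many words suffice.
Separation makes `pos` injective, hence the words can be indexed by their positions. -/
theorem exists_gluing {Y : Set (TwoSided A)} {N : ℕ} (hN : 0 < N) (hYne : Y.Nonempty)
    (hYc : IsCompact Y) (hYN : shift^[N] '' Y = Y)
    (hspec : NonUniformSpecification (shift (A := A))^[N] Y) :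
    ∃ p : ℕ → ℕ, Tendsto (fun n : ℕ => (p n : ℝ) / n) atTop (𝓝 0) ∧ Gluing Y N p := by
  classical
  obtain ⟨p, -, hp0, hp⟩ := hspec (Real.exp (-(N : ℝ))) (Real.exp_pos _)
  refine ⟨p, hp0, ?_⟩
  intro ι pos ℓ y hy hsep
  rcases isEmpty_or_nonempty ι with hι | hι
  · obtain ⟨z, hz⟩ := hYne
    exact ⟨z, hz, fun i => hι.elim i⟩
  have hinj : Function.Injective pos := by
    intro i j hij
    by_contra hne
    have h1 := (hy i).2
    have h2 := (hy j).2
    rcases hsep i j hne with h | h <;> omega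
  have hinv : ∀ i, Function.invFun pos (pos i) = i := Function.leftInverse_invFun hinj
  obtain ⟨z, hzY, hz⟩ := hYc.inter_iInter_nonempty
    (fun i : ι => ⋂ k : ℤ, ⋂ (_ : N * pos i ≤ k ∧ k < N * (pos i + ℓ i)), {z | z k = y i k})
    (fun i => isClosed_iInter fun k => isClosed_iInter fun _ => isClosed_coord_eq k _) (by
      intro F
      obtain ⟨z, hzY, hz⟩ := exists_glue_finset hN hYne hYN hp (F.image pos)
        (fun v => ℓ (Function.invFun pos v)) (fun v => y (Function.invFun pos v)) (by
          intro v hv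
          exact hy _) (by
          intro v hv w hw hvw
          obtain ⟨i, -, rfl⟩ := Finset.mem_image.1 hv
          obtain ⟨j, -, rfl⟩ := Finset.mem_image.1 hw
          rw [hinv]
          rcases hsep i j (fun h => by simp [h] at hvw) with h | h
          · exact h
          · omega)
      refine ⟨z, hzY, mem_iInter₂.2 fun i hi => mem_iInter₂.2 fun k hk => ?_⟩
      have := hz (pos i) (Finset.mem_image_of_mem _ hi) k hk.1 (by rw [hinv]; exact hk.2)
      rwa [hinv] at this)
  refine ⟨z, hzY, fun i k hk hk' => ?_⟩
  exact mem_iInter₂.1 (mem_iInter.1 hz i) k ⟨hk, hk'⟩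

end TwoSided

/-! ### Blocked intervals of density at most `1 - c` -/

/-- The integers outside of all the intervals `[b k, e k)`. -/
def freeSet (b e : ℕ → ℕ) : Set ℤ := {j | ∀ k, ¬ ((b k : ℤ) ≤ j ∧ j < e k)}

-- The proportion of free integers is smallest when `J = e k`, and the free stretch just before `b
-- k` already has at least `c * e k` elements.
open Classical in
theorem le_card_free {b e : ℕ → ℕ} {c : ℝ} (hc0 : 0 ≤ c) (hc1 : c ≤ 1) (hbe : ∀ k, b k < e k)
    (h0 : c * e 0 ≤ b 0) (hs : ∀ k, c * e (k + 1) + e k ≤ b (k + 1)) (J : ℕ) :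
    c * J ≤ ((Finset.range J).filter fun j : ℕ => (j : ℤ) ∈ freeSet b e).card := by
  have heb : ∀ k, e k ≤ b (k + 1) := fun k => by
    have h1 : (0 : ℝ) ≤ c * e (k + 1) := by positivity
    have h2 := hs k
    have : (e k : ℝ) ≤ b (k + 1) := by linarith
    exact_mod_cast this
  have hb : StrictMono b := strictMono_nat_of_lt_succ fun k => (hbe k).trans_le (heb k)
  have he : StrictMono e := strictMono_nat_of_lt_succ fun k => (heb k).trans_lt (hbe (k + 1))
  have hex : ∃ k, J ≤ b k := ⟨J, hb.id_le J⟩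
  have hfree : ∀ k j : ℕ, j < b k → (∀ i < k, e i ≤ j) → (j : ℤ) ∈ freeSet b e := by
    intro k j hj hi i hij
    rcases lt_or_ge i k with hik | hik
    · have := hi i hik
      omega
    · have := hb.monotone hik
      omega
  classical
  -- In the second case `b k < J ≤ b (k + 1)`.
  rcases hk : Nat.find hex with _ | k
  · have hJ := Nat.find_spec hex
    rw [hk] at hJ
    have : ((Finset.range J).filter fun j : ℕ => (j : ℤ) ∈ freeSet b e) = Finset.range J :=
      Finset.filter_true_of_mem fun j hj =>
        hfree 0 j (by have := Finset.mem_range.1 hj; omega) (by simp)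
    rw [this, Finset.card_range]
    exact mul_le_of_le_one_left (Nat.cast_nonneg _) hc1
  · have hJ := Nat.find_spec hex
    rw [hk] at hJ
    have hJ' : b k < J := by
      have := Nat.find_min hex (m := k) (by omega)
      omega
    obtain ⟨prev, hprev, hprev'⟩ : ∃ prev : ℕ, c * e k + prev ≤ b k ∧ ∀ i < k, e i ≤ prev := by
      rcases k with _ | k
      · exact ⟨0, by simpa using h0, by simp⟩
      · exact ⟨e k, hs k, fun i hi => he.monotone (by omega)⟩
    -- The second interval is empty if `J` lies inside the blocked interval, so both positions of
    -- `J` are treated at once.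
    have hsub : Finset.Ico prev (b k) ∪ Finset.Ico (e k) J ⊆
        (Finset.range J).filter fun j : ℕ => (j : ℤ) ∈ freeSet b e := by
      intro j hj
      rw [Finset.mem_filter, Finset.mem_range]
      rcases Finset.mem_union.1 hj with h | h
      · rw [Finset.mem_Ico] at h
        exact ⟨by omega, hfree k j h.2 fun i hi => (hprev' i hi).trans h.1⟩
      · rw [Finset.mem_Ico] at h
        exact ⟨h.2, hfree (k + 1) j (by omega) fun i hi => (he.monotone (by omega)).trans h.1⟩
    have hcard := Finset.card_le_card hsub
    rw [Finset.card_union_of_disjoint, Nat.card_Ico, Nat.card_Ico] at hcard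
    · have hbk : (b k : ℝ) ≤ ((b k - prev : ℕ) : ℝ) + prev := by
        exact_mod_cast (by omega : b k ≤ (b k - prev) + prev)
      have hcard' : ((b k - prev : ℕ) : ℝ) + ((J - e k : ℕ) : ℝ) ≤
          ((Finset.range J).filter fun j : ℕ => (j : ℤ) ∈ freeSet b e).card := by
        exact_mod_cast hcard
      have hJe : (J : ℝ) ≤ ((J - e k : ℕ) : ℝ) + e k := by
        exact_mod_cast (by omega : J ≤ (J - e k) + e k)
      have h3 : c * J ≤ c * ((J - e k : ℕ) : ℝ) + c * e k := by
        rw [← mul_add]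
        gcongr
      have h4 : c * ((J - e k : ℕ) : ℝ) ≤ ((J - e k : ℕ) : ℝ) :=
        mul_le_of_le_one_left (Nat.cast_nonneg _) hc1
      linarith
    · rw [Finset.disjoint_left]
      intro j hj hj'
      rw [Finset.mem_Ico] at hj hj'
      have := hbe k
      omega

theorem exists_le_mul_add {p : ℕ → ℕ} (hp : Tendsto (fun n : ℕ => (p n : ℝ) / n) atTop (𝓝 0))
    {δ : ℝ} (hδ : 0 < δ) : ∃ C : ℝ, 0 ≤ C ∧ ∀ n : ℕ, (p n : ℝ) ≤ δ * n + C := by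
  obtain ⟨n₀, hn₀⟩ := eventually_atTop.1
    ((hp.eventually_lt_const hδ).and (eventually_gt_atTop 0))
  refine ⟨∑ i ∈ Finset.range n₀, (p i : ℝ), by positivity, fun n => ?_⟩
  rcases lt_or_ge n n₀ with hn | hn
  · have := Finset.single_le_sum (f := fun i : ℕ => (p i : ℝ)) (fun i _ => by positivity)
      (Finset.mem_range.2 hn)
    have h2 : 0 ≤ δ * n := by positivity
    linarith
  · obtain ⟨h1, h2⟩ := hn₀ n hn
    have h2' : (0 : ℝ) < n := by exact_mod_cast h2
    rw [div_lt_iff₀ h2'] at h1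
    have : (0 : ℝ) ≤ ∑ i ∈ Finset.range n₀, (p i : ℝ) := by positivity
    linarith

/-- The coordinates `[n + a - r, n + a + r]` of a target at a late time `n` are contained in
`N * [v, v + ℓ)`, and the lattice cells met by `[v, v + ℓ + p ℓ)` lie far out compared to their
number. -/
theorem eventually_mul_add_le {p : ℕ → ℕ}
    (hp : Tendsto (fun n : ℕ => (p n : ℝ) / n) atTop (𝓝 0)) {N P : ℕ} (hN : 0 < N) (hP : 0 < P)
    (a : ℕ) {t c : ℝ} (ht1 : t < 1) (hc0 : 0 ≤ c) (hct : c * (1 + t) < 1 - t)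
    (M : ℝ) :
    ∀ᶠ n : ℕ in atTop, ∀ r v ℓ : ℕ, (r : ℝ) ≤ t * n → v = (n + a - r) / N →
      ℓ = (n + a + r) / N - v + 1 →
      c * (((v + ℓ + p ℓ) / P + 1 : ℕ) : ℝ) + M ≤ ((v / P : ℕ) : ℝ) := by
  -- The gap `p ℓ` is at most `δ * ℓ` up to a constant, and `ℓ` is about `2 * n / N` at most; this
  -- is the origin of `2 * δ`.
  obtain ⟨δ, hδ, hcδ⟩ : ∃ δ : ℝ, 0 < δ ∧ c * (1 + t + 2 * δ) < 1 - t := by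
    have h1 : ∀ᶠ δ : ℝ in 𝓝[>] 0, c * (1 + t + 2 * δ) < 1 - t := by
      have : Tendsto (fun δ : ℝ => c * (1 + t + 2 * δ)) (𝓝 0) (𝓝 (c * (1 + t + 2 * 0))) :=
        Continuous.tendsto (by fun_prop) 0
      rw [mul_zero, add_zero] at this
      exact (this.eventually_lt_const hct).filter_mono nhdsWithin_le_nhds
    obtain ⟨δ, h, h'⟩ := (h1.and self_mem_nhdsWithin).exists
    exact ⟨δ, h', h⟩
  obtain ⟨C, hC0, hC⟩ := exists_le_mul_add hp hδ
  have hN' : (0 : ℝ) < N := by exact_mod_cast hN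
  have hP' : (0 : ℝ) < P := by exact_mod_cast hP
  set θ : ℝ := (1 - t) - c * (1 + t + 2 * δ) with hθ
  have hθ0 : 0 < θ := by linarith
  have hlim : Tendsto (fun n : ℕ => θ / (N * P) * (n : ℝ)) atTop atTop :=
    tendsto_natCast_atTop_atTop.const_mul_atTop (by positivity)
  filter_upwards [hlim.eventually_ge_atTop
    (M + c * ((a / N + 1 + δ * 2 + C) / P + 1) + 1 / P + 1)] with n hn r v ℓ hr hv hℓ
  have hrn : r ≤ n := by
    have : (r : ℝ) ≤ n := hr.trans (mul_le_of_le_one_left (Nat.cast_nonneg _) ht1.le)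
    exact_mod_cast this
  have hv1 : ((n + a - r : ℕ) : ℝ) / N - 1 ≤ v := by
    rw [hv]
    have h1 : n + a - r ≤ N * ((n + a - r) / N) + N := by
      have := Nat.div_add_mod (n + a - r) N
      have := Nat.mod_lt (n + a - r) hN
      omega
    have h2 : ((n + a - r : ℕ) : ℝ) ≤ N * (((n + a - r) / N : ℕ) : ℝ) + N := by exact_mod_cast h1
    rw [sub_le_iff_le_add, div_le_iff₀ hN']
    linarith
  have hv2 : ((1 - t) * n) / N - 1 ≤ v := by
    refine le_trans ?_ hv1
    rw [Nat.cast_sub (by omega)]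
    push_cast
    have ha : (0 : ℝ) ≤ a := Nat.cast_nonneg a
    gcongr
    linarith
  have hvle : v ≤ (n + a + r) / N := by
    rw [hv]
    exact Nat.div_le_div_right (by omega)
  have hvl : ((v + ℓ : ℕ) : ℝ) ≤ (n * (1 + t) + a) / N + 1 := by
    have h1 : v + ℓ = (n + a + r) / N + 1 := by omega
    rw [h1]
    push_cast
    have h2 : (((n + a + r) / N : ℕ) : ℝ) ≤ ((n + a + r : ℕ) : ℝ) / N := Nat.cast_div_le
    have h3 : ((n + a + r : ℕ) : ℝ) / N ≤ (n * (1 + t) + a) / N := by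
      refine div_le_div_of_nonneg_right ?_ hN'.le
      push_cast
      linarith
    linarith
  have hl2 : (ℓ : ℝ) ≤ 2 * n / N + 2 := by
    have h1 : (ℓ : ℝ) = ((v + ℓ : ℕ) : ℝ) - v := by push_cast; ring
    have h2 : (n * (1 + t) + a) / (N : ℝ) - ((n + a - r : ℕ) : ℝ) / N ≤ 2 * n / N := by
      rw [← sub_div, Nat.cast_sub (by omega)]
      push_cast
      gcongr
      nlinarith [Nat.cast_nonneg (α := ℝ) n]
    linarith
  have hb : (v : ℝ) / P - 1 ≤ ((v / P : ℕ) : ℝ) := by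
    have h1 : v ≤ P * (v / P) + P := by
      have := Nat.div_add_mod v P
      have := Nat.mod_lt v hP
      omega
    have h2 : (v : ℝ) ≤ P * ((v / P : ℕ) : ℝ) + P := by exact_mod_cast h1
    rw [sub_le_iff_le_add, div_le_iff₀ hP']
    linarith
  have he : (((v + ℓ + p ℓ) / P + 1 : ℕ) : ℝ) ≤
      ((n * (1 + t) + a) / N + 1 + (δ * (2 * n / N + 2) + C)) / P + 1 := by
    push_cast
    have h1 : (((v + ℓ + p ℓ) / P : ℕ) : ℝ) ≤ ((v + ℓ + p ℓ : ℕ) : ℝ) / P := Nat.cast_div_le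
    have h2 : (p ℓ : ℝ) ≤ δ * (2 * n / N + 2) + C := (hC ℓ).trans (by gcongr)
    have h3 : ((v + ℓ + p ℓ : ℕ) : ℝ) / P ≤
        ((n * (1 + t) + a) / N + 1 + (δ * (2 * n / N + 2) + C)) / P := by
      rw [Nat.cast_add]
      gcongr
    linarith
  have hce := mul_le_mul_of_nonneg_left he hc0
  have hvP : (((1 - t) * n) / N - 1) / P ≤ (v : ℝ) / P := by gcongr
  -- All rounding errors are independent of `n`, so the positive slope `θ / (N * P)` eventually
  -- absorbs them.
  have hkey : (((1 - t) * n) / N - 1) / P - 1 -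
      c * (((n * (1 + t) + a) / N + 1 + (δ * (2 * n / N + 2) + C)) / P + 1) =
      θ / (N * P) * (n : ℝ) - (c * ((a / N + 1 + δ * 2 + C) / P + 1) + 1 / P + 1) := by
    rw [hθ]
    field_simp
    ring
  linarith

/-! ### Uniform product measure -/

/-- An outer measure is enough for the mass estimates and spares any measurability of the coding
map. -/
theorem exists_uniform_outerMeasure (ι Λ : Type*) [Finite Λ] [Nonempty Λ] :
    ∃ μ : MeasureTheory.OuterMeasure (ι → Λ), μ univ = 1 ∧
      ∀ (S : Set (ι → Λ)) (F : Finset ι), (∀ ω ∈ S, ∀ ω' ∈ S, ∀ j ∈ F, ω j = ω' j) →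
        μ S ≤ ENNReal.ofReal (Real.exp (-(Real.log (Nat.card Λ) * F.card))) := by
  classical
  let _ : MeasurableSpace Λ := ⊤
  have : Fintype Λ := Fintype.ofFinite Λ
  let ν : MeasureTheory.Measure Λ := (PMF.uniformOfFintype Λ).toMeasure
  refine ⟨(MeasureTheory.Measure.infinitePi fun _ : ι => ν).toOuterMeasure,
    MeasureTheory.measure_univ (μ := MeasureTheory.Measure.infinitePi fun _ : ι => ν), ?_⟩
  intro S F hS
  rcases S.eq_empty_or_nonempty with rfl | ⟨ω₀, hω₀⟩
  · simp
  have hsub : S ⊆ (F : Set ι).pi fun j => {ω₀ j} := fun ω hω j hj => hS ω hω ω₀ hω₀ j hj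
  refine (MeasureTheory.measure_mono hsub).trans ?_
  have h1 := MeasureTheory.Measure.infinitePi_pi (fun _ : ι => ν) (s := F)
    (t := fun j => {ω₀ j}) (fun _ _ => MeasurableSpace.measurableSet_top)
  refine h1.le.trans ?_
  have h2 : ∀ j, ν {ω₀ j} = ENNReal.ofReal (Real.exp (-Real.log (Nat.card Λ))) := by
    intro j
    rw [PMF.toMeasure_apply_singleton _ _ MeasurableSpace.measurableSet_top, PMF.uniformOfFintype_apply, Real.exp_neg,
      Real.exp_log (by exact_mod_cast Nat.card_pos), ENNReal.ofReal_inv_of_pos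
      (by exact_mod_cast Nat.card_pos), ENNReal.ofReal_natCast, Nat.card_eq_fintype_card]
  simp only [h2, Finset.prod_const]
  rw [← ENNReal.ofReal_pow (Real.exp_pos _).le, ← Real.exp_nat_mul]
  apply le_of_eq
  congr 2
  ring

namespace TwoSided

variable {A : Type*}

/-! ### The Moran construction -/

/-- Points with prescribed words `w k` at sparse places and arbitrary words in the cells of a
lattice that do not meet these places. -/
theorem exists_coding {Y : Set (TwoSided A)} {N : ℕ} (hYN : shift^[N] '' Y = Y) {p : ℕ → ℕ}
    (hglue : Gluing Y N p) {B P : ℕ} (hB : 1 ≤ B) (hP : P = B + p B) {b e v ℓ : ℕ → ℕ}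
    {w : ℕ → TwoSided A} (hw : ∀ k, w k ∈ Y) (hℓ : ∀ k, 1 ≤ ℓ k) (hbv : ∀ k, P * b k ≤ v k)
    (hve : ∀ k, v k + ℓ k + p (ℓ k) ≤ P * e k) (heb : ∀ k, e k ≤ b (k + 1)) :
    ∃ Φ : (ℤ → ↥(wordAt 0 (N * B) '' Y)) → TwoSided A, ∀ ω, Φ ω ∈ Y ∧
      (∀ k, ∀ i : ℤ, N * (v k : ℤ) ≤ i → i < N * (v k + ℓ k : ℤ) → Φ ω i = w k i) ∧
      ∀ j ∈ freeSet b e, wordAt (N * (P * j)) (N * B) (Φ ω) = ω j := by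
  have hP0 : 0 < P := by omega
  have hbe : ∀ k, b k < e k := fun k => by
    have h1 := hbv k
    have h2 := hve k
    have h3 := hℓ k
    exact Nat.lt_of_mul_lt_mul_left (a := P) (by omega)
  have hb : Monotone b := monotone_nat_of_le_succ fun k => (hbe k).le.trans (heb k)
  choose rep hrepY hrep using fun q : ↥(wordAt 0 (N * B) '' Y) => q.2
  have key : ∀ ω : ℤ → ↥(wordAt 0 (N * B) '' Y), ∃ x : TwoSided A, x ∈ Y ∧
      (∀ k, ∀ i : ℤ, N * (v k : ℤ) ≤ i → i < N * (v k + ℓ k : ℤ) → x i = w k i) ∧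
      ∀ j ∈ freeSet b e, wordAt (N * (P * j)) (N * B) x = ω j := by
    intro ω
    have hmul : ∀ i j : ℤ, i < j → (P : ℤ) * i + B + p B ≤ P * j := fun i j hij => by
      have h1 : (P : ℤ) * (i + 1) ≤ P * j := by gcongr; omega
      have h2 : (P : ℤ) = B + p B := by exact_mod_cast hP
      linarith
    have hjv : ∀ (j : ℤ) (k : ℕ), j ∈ freeSet b e →
        (P : ℤ) * j + B + p B ≤ v k ∨ (v k : ℤ) + ℓ k + p (ℓ k) ≤ P * j := by
      intro j k hj
      rcases lt_or_ge j (b k) with h | h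
      · left
        have h1 := hmul j (b k) h
        have h2 : (P : ℤ) * b k ≤ v k := by exact_mod_cast hbv k
        linarith
      · right
        have h1 : (e k : ℤ) ≤ j := by
          by_contra hlt
          exact hj k ⟨h, by omega⟩
        have h2 : ((v k : ℤ) + ℓ k + p (ℓ k)) ≤ P * e k := by exact_mod_cast hve k
        have h3 : (P : ℤ) * e k ≤ P * j := by gcongr
        linarith
    have hvv : ∀ k k' : ℕ, k < k' → (v k : ℤ) + ℓ k + p (ℓ k) ≤ v k' := by
      intro k k' hk
      have h1 : e k ≤ b k' := (heb k).trans (hb hk)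
      have h2 : P * e k ≤ P * b k' := Nat.mul_le_mul_left P h1
      have h3 := hve k
      have h4 := hbv k'
      omega
    -- One family glues the free cells and the targets. A cell of length `P` holds a word of length
    -- `B` and its gap `p B`, in units of `N` coordinates.
    obtain ⟨x, hxY, hx⟩ := hglue (ι := ↥(freeSet b e) ⊕ ℕ)
      (Sum.elim (fun j => P * (j : ℤ)) (fun k => (v k : ℤ)))
      (Sum.elim (fun _ => B) ℓ)
      (Sum.elim (fun j => translate (N * -(P * (j : ℤ))) (rep (ω j))) w)
      (by
        rintro (j | k)
        · exact ⟨translate_mem hYN _ (hrepY _), hB⟩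
        · exact ⟨hw k, hℓ k⟩)
      (by
        rintro (⟨j, hj⟩ | k) (⟨j', hj'⟩ | k') hne
        · have hne' : j ≠ j' := fun h => hne (by subst h; rfl)
          rcases lt_or_gt_of_ne hne' with h | h
          · exact Or.inl (hmul _ _ h)
          · exact Or.inr (hmul _ _ h)
        · exact hjv j k' hj
        · exact (hjv j' k hj').symm
        · have hne' : k ≠ k' := fun h => hne (by subst h; rfl)
          rcases lt_or_gt_of_ne hne' with h | h
          · exact Or.inl (hvv _ _ h)
          · exact Or.inr (hvv _ _ h))
    refine ⟨x, hxY, fun k i hi hi' => hx (Sum.inr k) i hi hi', fun j hj => ?_⟩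
    rw [← hrep (ω j)]
    funext i
    have hi : (i : ℤ) < N * B := by exact_mod_cast i.2
    have := hx (Sum.inl ⟨j, hj⟩) (N * (P * j) + (i : ℕ)) (by simp) (by
      simp only [Sum.elim_inl]
      rw [mul_add]
      linarith)
    simp only [Sum.elim_inl, translate_apply] at this
    simp only [wordAt]
    rw [this]
    congr 1
    ring
  choose Φ hΦ using key
  exact ⟨Φ, hΦ⟩

variable [Finite A]

theorem numWords_le_mul {X Y : Set (TwoSided A)} {N : ℕ}
    (hXY : X = ⋃ l : Fin N, shift^[(l : ℕ)] '' Y) (n : ℕ) :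
    numWords X 0 n ≤ N * numWords Y 0 (n + N) := by
  have h1 : wordAt 0 n '' X = ⋃ l : Fin N, wordAt (l : ℕ) n '' Y := by
    rw [hXY, image_iUnion]
    refine iUnion_congr fun l => ?_
    rw [image_image]
    refine image_congr fun x _ => ?_
    funext i
    simp [wordAt, add_comm]
  have h2 : ∀ l : Fin N, (wordAt (l : ℕ) n '' Y).ncard ≤ numWords Y 0 (n + N) := fun l =>
    numWords_le_of_agree fun k hk hk' => ⟨by omega, by push_cast; omega⟩
  unfold numWords at h2 ⊢
  rw [h1]
  refine (Set.ncard_iUnion_le_of_fintype _).trans ?_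
  refine (Finset.sum_le_card_nsmul _ _ _ fun l _ => h2 l).trans ?_
  simp

/-- Long words of `Y` have nearly the full growth rate even when their gap is counted in their
length. The alternative `u' = 0` covers zero entropy. -/
theorem exists_block_length {X Y : Set (TwoSided A)} {N : ℕ} (hN : 0 < N) (hYne : Y.Nonempty)
    (hXY : X = ⋃ l : Fin N, shift^[(l : ℕ)] '' Y) {u : ℝ}
    (hu : ∀ n : ℕ, Real.exp (u * n) ≤ numWords X 0 n) {p : ℕ → ℕ}
    (hp : Tendsto (fun n : ℕ => (p n : ℝ) / n) atTop (𝓝 0)) {u' : ℝ} (hu'0 : 0 ≤ u')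
    (hu' : u' = 0 ∨ u' < u) :
    ∃ B : ℕ, 1 ≤ B ∧ u' * (N * (B + p B : ℕ)) ≤ Real.log (numWords Y 0 (N * B)) := by
  rcases hu' with rfl | hlt
  · exact ⟨1, le_rfl, by simpa using Real.log_natCast_nonneg _⟩
  have hN' : (0 : ℝ) < N := by exact_mod_cast hN
  obtain ⟨δ, hδ, hδu⟩ : ∃ δ : ℝ, 0 < δ ∧ u' * (1 + δ) < u := by
    have h1 : ∀ᶠ δ : ℝ in 𝓝[>] 0, u' * (1 + δ) < u := by
      have : Tendsto (fun δ : ℝ => u' * (1 + δ)) (𝓝 0) (𝓝 (u' * (1 + 0))) :=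
        Continuous.tendsto (by fun_prop) 0
      rw [add_zero, mul_one] at this
      exact (this.eventually_lt_const hlt).filter_mono nhdsWithin_le_nhds
    obtain ⟨δ, h, h'⟩ := (h1.and self_mem_nhdsWithin).exists
    exact ⟨δ, h', h⟩
  have hlim : Tendsto (fun B : ℕ => (N * (u - u' * (1 + δ))) * (B : ℝ)) atTop atTop :=
    tendsto_natCast_atTop_atTop.const_mul_atTop (mul_pos hN' (by linarith))
  obtain ⟨B, ⟨hB1, hB2⟩, hB3⟩ := ((hp.eventually_lt_const hδ).and
    (hlim.eventually_ge_atTop (u * N + Real.log N))|>.and (eventually_ge_atTop 1)).exists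
  refine ⟨B, hB3, ?_⟩
  have hB0 : (0 : ℝ) < B := by exact_mod_cast hB3
  rw [div_lt_iff₀ hB0] at hB1
  have h1 := numWords_le_mul hXY (N * B - N)
  have h2 : N * B - N + N = N * B := Nat.sub_add_cancel (Nat.le_mul_of_pos_right N hB3)
  rw [h2] at h1
  have hW0 : (0 : ℝ) < numWords Y 0 (N * B) := by exact_mod_cast numWords_pos hYne 0 _
  have h3 : Real.exp (u * (N * B - N : ℕ)) ≤ N * numWords Y 0 (N * B) :=
    (hu _).trans (by exact_mod_cast h1)
  rw [← Real.le_log_iff_exp_le (by positivity), Real.log_mul hN'.ne' hW0.ne',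
    Nat.cast_sub (Nat.le_mul_of_pos_right N hB3)] at h3
  push_cast at h3 ⊢
  have h4 : u' * (N * (B + p B)) ≤ u' * (N * (B + δ * B)) := by gcongr
  nlinarith

end TwoSided

namespace TwoSided

variable {A : Type*}

/-! ### Lower bounds by mass distribution -/

/-- Mass distribution at scale `1`, where two points of one dynamical ball of length `n` agree on
`[0, n)`: every cover has cost at least `1 / K`. -/
theorem le_bowenEntropy_of_mass {X W : Set (TwoSided A)} {Ω : Type*}
    (μ : MeasureTheory.OuterMeasure Ω) (hμ : μ univ = 1) {Φ : Ω → TwoSided A}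
    (hΦ : ∀ ω, Φ ω ∈ W) {K s : ℝ} (hK : 0 < K)
    (hmass : ∀ (S : Set Ω) (n : ℕ),
      (∀ ω ∈ S, ∀ ω' ∈ S, ∀ k : ℤ, 0 ≤ k → k < n → Φ ω k = Φ ω' k) →
      μ S ≤ ENNReal.ofReal (K * Real.exp (-s * n))) :
    ENNReal.ofReal s ≤ bowenEntropy shift X W := by
  refine le_trans ?_ (le_iSup₂ (f := fun (ε : ℝ) (_ : 0 < ε) => bowenEntropyAt shift X W ε)
    1 one_pos)
  refine le_iInf₂ fun σ hσ => ?_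
  by_contra hlt
  rw [not_le, ← ENNReal.ofReal_coe_nnreal] at hlt
  have hσs : (σ : ℝ) < s := (ENNReal.ofReal_lt_ofReal_iff_of_nonneg σ.2).1 hlt
  have hpre : bowenPre shift X W 1 1 σ = 0 := by
    have := ENNReal.iSup_eq_zero.1 hσ 0
    simpa using this
  have hK' : (0 : ℝ≥0∞) < (ENNReal.ofReal K)⁻¹ := ENNReal.inv_pos.2 ENNReal.ofReal_ne_top
  rw [← hpre] at hK'
  obtain ⟨C, hC⟩ := iInf_lt_iff.1 hK'
  obtain ⟨⟨hCc, -, hcov⟩, hsum⟩ := iInf_lt_iff.1 hC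
  have hball : ∀ c : TwoSided A × ℕ, μ (Φ ⁻¹' dynBall shift X c.2 c.1 1) ≤
      ENNReal.ofReal K * ENNReal.ofReal (Real.exp (-(σ : ℝ) * c.2)) := by
    intro c
    refine (hmass _ c.2 ?_).trans ?_
    · intro ω hω ω' hω' k hk hk'
      have h1 := (dist_lt_one_iff _ _).1 (hω.2 k.toNat (by omega))
      have h2 := (dist_lt_one_iff _ _).1 (hω'.2 k.toNat (by omega))
      simp only [shift_iterate_apply, zero_add, Int.toNat_of_nonneg hk] at h1 h2
      rw [← h1, ← h2]
    · rw [← ENNReal.ofReal_mul hK.le]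
      gcongr
  have h1 : (1 : ℝ≥0∞) ≤
      ENNReal.ofReal K * ∑' c : C, ENNReal.ofReal (Real.exp (-(σ : ℝ) * (c.1.2 : ℝ))) := by
    rw [← ENNReal.tsum_mul_left, ← hμ]
    calc μ univ ≤ μ (⋃ c ∈ C, Φ ⁻¹' dynBall shift X c.2 c.1 1) := by
          refine MeasureTheory.measure_mono fun ω _ => ?_
          have := hcov (hΦ ω)
          simpa using this
      _ ≤ ∑' c : C, μ (Φ ⁻¹' dynBall shift X c.1.2 c.1.1 1) :=
          MeasureTheory.measure_biUnion_le μ hCc _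
      _ ≤ _ := ENNReal.tsum_le_tsum fun c => hball c.1
  have h2 := ENNReal.mul_lt_mul_right (a := ENNReal.ofReal K) (by simpa using hK)
    ENNReal.ofReal_ne_top hsum
  rw [ENNReal.mul_inv_cancel (by simpa using hK) ENNReal.ofReal_ne_top] at h2
  exact absurd h1 (not_le.2 h2)

theorem le_dimH_of_mass {W : Set (TwoSided A)} {Ω : Type*}
    (μ : MeasureTheory.OuterMeasure Ω) (hμ : μ univ = 1) {Φ : Ω → TwoSided A}
    (hΦ : ∀ ω, Φ ω ∈ W) {K s : ℝ} (hK : 0 < K)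
    (hmass : ∀ (S : Set Ω) (m : ℕ),
      (∀ ω ∈ S, ∀ ω' ∈ S, ∀ k : ℤ, k.natAbs < m → Φ ω k = Φ ω' k) →
      μ S ≤ ENNReal.ofReal (K * Real.exp (-s * m))) :
    ENNReal.ofReal s ≤ dimH W := by
  borelize (TwoSided A)
  rcases le_or_gt s 0 with hs | hs
  · rw [ENNReal.ofReal_of_nonpos hs]
    exact bot_le
  refine le_dimH_of_hausdorffMeasure_ne_zero (d := s.toNNReal) ?_
  rw [Real.coe_toNNReal s hs.le, MeasureTheory.Measure.hausdorffMeasure_apply]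
  intro hzero
  have hpre := ENNReal.iSup_eq_zero.1 (ENNReal.iSup_eq_zero.1 hzero 1) one_pos
  -- Rounding `-log d` down to an integer costs at most a factor `exp s`.
  set K' : ℝ := K * Real.exp s with hK'def
  have hK'0 : 0 < K' := by positivity
  have hK' : (0 : ℝ≥0∞) < (ENNReal.ofReal K')⁻¹ := ENNReal.inv_pos.2 ENNReal.ofReal_ne_top
  rw [← hpre] at hK'
  obtain ⟨t, ht⟩ := iInf_lt_iff.1 hK'
  obtain ⟨hcov, ht⟩ := iInf_lt_iff.1 ht
  obtain ⟨hdiam, hsum⟩ := iInf_lt_iff.1 ht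
  have hset : ∀ n, μ (Φ ⁻¹' t n) ≤
      ENNReal.ofReal K' * ⨆ _ : (t n).Nonempty, Metric.ediam (t n) ^ s := by
    intro n
    rcases (t n).eq_empty_or_nonempty with hemp | hne
    · simp [hemp]
    rw [iSup_pos hne]
    have hagree : ∀ m : ℕ, Metric.ediam (t n) ≤ ENNReal.ofReal (Real.exp (-(m : ℝ))) →
        μ (Φ ⁻¹' t n) ≤ ENNReal.ofReal (K * Real.exp (-s * m)) := by
      intro m hm
      refine hmass _ m fun ω hω ω' hω' => (dist_le_exp_iff _ _ _).1 ?_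
      have := (Metric.edist_le_ediam_of_mem (s := t n) hω hω').trans hm
      rwa [edist_dist, ENNReal.ofReal_le_ofReal_iff (Real.exp_pos _).le] at this
    rcases eq_or_ne (Metric.ediam (t n)) 0 with h0 | h0
    -- A set of diameter zero satisfies the mass bound for every `m`, hence is null.
    · have hlim : Tendsto (fun m : ℕ => ENNReal.ofReal (K * Real.exp (-s * m))) atTop (𝓝 0) := by
        rw [← ENNReal.ofReal_zero]
        refine ENNReal.tendsto_ofReal ?_
        rw [← mul_zero K]
        refine Tendsto.const_mul K (Real.tendsto_exp_atBot.comp ?_)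
        exact tendsto_natCast_atTop_atTop.const_mul_atTop_of_neg (by linarith)
      have : μ (Φ ⁻¹' t n) ≤ 0 := ge_of_tendsto' hlim fun m => hagree m (by rw [h0]; exact bot_le)
      exact this.trans bot_le
    · have htop : Metric.ediam (t n) ≠ ∞ := ne_top_of_le_ne_top ENNReal.one_ne_top (hdiam n)
      obtain ⟨d, hd⟩ : ∃ d : ℝ, d = (Metric.ediam (t n)).toReal := ⟨_, rfl⟩
      have hd0 : 0 < d := hd ▸ ENNReal.toReal_pos h0 htop
      have hde : Metric.ediam (t n) = ENNReal.ofReal d := by rw [hd, ENNReal.ofReal_toReal htop]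
      have hd1 : d ≤ 1 := by
        have := hdiam n
        rw [hde, ← ENNReal.ofReal_one, ENNReal.ofReal_le_ofReal_iff zero_le_one] at this
        exact this
      have hlog : 0 ≤ -Real.log d := neg_nonneg.2 (Real.log_nonpos hd0.le hd1)
      refine (hagree ⌊-Real.log d⌋₊ ?_).trans ?_
      · rw [hde]
        refine ENNReal.ofReal_le_ofReal ?_
        rw [← Real.log_le_iff_le_exp hd0]
        have := Nat.floor_le hlog
        linarith
      · rw [hde, ENNReal.ofReal_rpow_of_pos hd0, ← ENNReal.ofReal_mul hK'0.le]
        refine ENNReal.ofReal_le_ofReal ?_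
        rw [hK'def, mul_assoc, Real.rpow_def_of_pos hd0, ← Real.exp_add]
        gcongr
        have := (Nat.lt_floor_add_one (-Real.log d)).le
        nlinarith
  have h1 : (1 : ℝ≥0∞) ≤
      ENNReal.ofReal K' * ∑' n, ⨆ _ : (t n).Nonempty, Metric.ediam (t n) ^ s := by
    rw [← ENNReal.tsum_mul_left, ← hμ]
    calc μ univ ≤ μ (⋃ n, Φ ⁻¹' t n) := by
          refine MeasureTheory.measure_mono fun ω _ => ?_
          have := hcov (hΦ ω)
          simpa using this
      _ ≤ ∑' n, μ (Φ ⁻¹' t n) := MeasureTheory.measure_iUnion_le _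
      _ ≤ _ := ENNReal.tsum_le_tsum hset
  have h2 := ENNReal.mul_lt_mul_right (a := ENNReal.ofReal K') (by simpa using hK'0)
    ENNReal.ofReal_ne_top hsum
  rw [ENNReal.mul_inv_cancel (by simpa using hK'0) ENNReal.ofReal_ne_top] at h2
  exact absurd h1 (not_le.2 h2)

/-- The condition on `c` lets a late target block start beyond `c` times its end. Since only
infinitely many usable times for each `j` are assumed, the lemma serves both the limsup and the
liminf bounds. -/
theorem exists_mass [Finite A] {X Y : Set (TwoSided A)} (hX : IsSubshift X) {N : ℕ} (hN : 0 < N)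
    (hYne : Y.Nonempty) (hYX : Y ⊆ X) (hYN : shift^[N] '' Y = Y)
    (hXY : X = ⋃ l : Fin N, shift^[(l : ℕ)] '' Y) {p : ℕ → ℕ}
    (hp : Tendsto (fun n : ℕ => (p n : ℝ) / n) atTop (𝓝 0)) (hglue : Gluing Y N p) {u : ℝ}
    (hu : ∀ n : ℕ, Real.exp (u * n) ≤ numWords X 0 n)
    {φ : ℕ → ℕ → ℝ} (hφ : ∀ j n, 0 < φ j n ∧ φ j n ≤ 1) {z : ℕ → ℕ → TwoSided A} {S : ℕ → Set ℕ}
    {a : ℕ} (haN : a < N) {t : ℝ} (ht1 : t < 1)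
    (hT : ∀ j, {n : ℕ | n ∈ S j ∧ -Real.log (φ j n) ≤ t * n ∧
      translate (-(n + a)) (z j n) ∈ Y}.Infinite)
    {c u' : ℝ} (hc0 : 0 ≤ c) (hc1 : c ≤ 1) (hct : c * (1 + t) < 1 - t) (hu'0 : 0 ≤ u')
    (hu' : u' = 0 ∨ u' < u) :
    ∃ (B : ℕ) (μ : MeasureTheory.OuterMeasure (ℤ → ↥(wordAt 0 (N * B) '' Y)))
      (Φ : (ℤ → ↥(wordAt 0 (N * B) '' Y)) → TwoSided A) (K : ℝ), μ univ = 1 ∧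
      (∀ ω, Φ ω ∈ ⋂ j, shrinkingTargetSet shift X (φ j) (z j) (S j)) ∧ 0 < K ∧
      (∀ (E : Set (ℤ → ↥(wordAt 0 (N * B) '' Y))) (n : ℕ),
        (∀ ω ∈ E, ∀ ω' ∈ E, ∀ k : ℤ, 0 ≤ k → k < n → Φ ω k = Φ ω' k) →
        μ E ≤ ENNReal.ofReal (K * Real.exp (-(c * u') * n))) ∧
      (∀ (E : Set (ℤ → ↥(wordAt 0 (N * B) '' Y))) (m : ℕ),
        (∀ ω ∈ E, ∀ ω' ∈ E, ∀ k : ℤ, k.natAbs < m → Φ ω k = Φ ω' k) →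
        μ E ≤ ENNReal.ofReal (K * Real.exp (-((1 + c) * u') * m))) := by
  classical
  obtain ⟨B, hB, hBu⟩ := exists_block_length hN hYne hXY hu hp hu'0 hu'
  set P : ℕ := B + p B with hP
  have hP0 : 0 < P := by omega
  -- the data of a target of index `j` at the time `n`
  let r : ℕ → ℕ → ℕ := fun j n => ⌊-Real.log (φ j n)⌋₊
  let v' : ℕ → ℕ → ℕ := fun j n => (n + a - r j n) / N
  let ℓ' : ℕ → ℕ → ℕ := fun j n => (n + a + r j n) / N - v' j n + 1
  let b' : ℕ → ℕ → ℕ := fun j n => v' j n / P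
  let e' : ℕ → ℕ → ℕ := fun j n => (v' j n + ℓ' j n + p (ℓ' j n)) / P + 1
  have hrlog : ∀ j n, (r j n : ℝ) ≤ -Real.log (φ j n) := fun j n =>
    Nat.floor_le (neg_nonneg.2 (Real.log_nonpos (hφ j n).1.le (hφ j n).2))
  have hstep : ∀ j M : ℕ, ∃ n : ℕ, (n ∈ S j ∧ -Real.log (φ j n) ≤ t * n ∧
      translate (-(n + a)) (z j n) ∈ Y) ∧ c * e' j n + M ≤ b' j n := by
    intro j M
    have hev := eventually_mul_add_le hp hN hP0 a ht1 hc0 hct M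
    obtain ⟨n, hn, hn'⟩ :=
      ((Nat.frequently_atTop_iff_infinite.2 (hT j)).and_eventually hev).exists
    exact ⟨n, hn, hn' (r j n) (v' j n) (ℓ' j n) ((hrlog j n).trans hn.2.1) rfl rfl⟩
  choose next hnext hnext' using hstep
  -- Unpairing visits every target index infinitely often.
  let J : ℕ → ℕ := fun k => (Nat.unpair k).1
  -- Each time is chosen late with respect to the end of the preceding blocked interval.
  obtain ⟨τ, hτ0, hτs⟩ : ∃ τ : ℕ → ℕ, τ 0 = next (J 0) 0 ∧
      ∀ k, τ (k + 1) = next (J (k + 1)) (e' (J k) (τ k)) :=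
    ⟨fun k => Nat.rec (next (J 0) 0) (fun k n => next (J (k + 1)) (e' (J k) n)) k, rfl,
      fun _ => rfl⟩
  let b : ℕ → ℕ := fun k => b' (J k) (τ k)
  let e : ℕ → ℕ := fun k => e' (J k) (τ k)
  let v : ℕ → ℕ := fun k => v' (J k) (τ k)
  let ℓ : ℕ → ℕ := fun k => ℓ' (J k) (τ k)
  have hτ : ∀ k, τ k ∈ S (J k) ∧ -Real.log (φ (J k) (τ k)) ≤ t * τ k ∧
      translate (-(τ k + a)) (z (J k) (τ k)) ∈ Y := by
    rintro (_ | k)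
    · rw [hτ0]
      exact hnext _ _
    · rw [hτs]
      exact hnext _ _
  have hbe0 : c * e 0 ≤ b 0 := by
    have := hnext' (J 0) 0
    rw [← hτ0] at this
    simpa using this
  have hbes : ∀ k, c * e (k + 1) + e k ≤ b (k + 1) := fun k => by
    have := hnext' (J (k + 1)) (e' (J k) (τ k))
    rwa [← hτs k] at this
  have heb : ∀ k, e k ≤ b (k + 1) := fun k => by
    have h1 : (0 : ℝ) ≤ c * e (k + 1) := by positivity
    have h2 := hbes k
    have : (e k : ℝ) ≤ b (k + 1) := by linarith
    exact_mod_cast this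
  have hbv : ∀ k, P * b k ≤ v k := fun k => Nat.mul_div_le _ _
  have hve : ∀ k, v k + ℓ k + p (ℓ k) ≤ P * e k := fun k =>
    (Nat.lt_mul_div_succ (v k + ℓ k + p (ℓ k)) hP0).le
  have hℓ : ∀ k, 1 ≤ ℓ k := fun k => Nat.le_add_left 1 _
  have hbe : ∀ k, b k < e k := fun k => by
    have h1 := hbv k
    have h2 := hve k
    have h3 := hℓ k
    exact Nat.lt_of_mul_lt_mul_left (a := P) (by omega)
  have hb : StrictMono b := strictMono_nat_of_lt_succ fun k => (hbe k).trans_le (heb k)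
  obtain ⟨Φ, hΦ⟩ := exists_coding hYN hglue hB hP
    (w := fun k => translate (-(τ k + a)) (z (J k) (τ k))) (fun k => (hτ k).2.2) hℓ hbv hve heb
  have hne : Nonempty ↥(wordAt 0 (N * B) '' Y) := (hYne.image _).to_subtype
  obtain ⟨μ, hμ1, hμ⟩ := exists_uniform_outerMeasure ℤ ↥(wordAt 0 (N * B) '' Y)
  set Q : ℝ := N * (P : ℕ) with hQ
  have hQ0 : 0 < Q := by positivity
  have hcardlog : u' * Q ≤ Real.log (Nat.card ↥(wordAt 0 (N * B) '' Y)) := by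
    rw [Nat.card_coe_set_eq]
    exact hBu
  -- The slack `4 * Q` pays for rounding, at most `2 * Q` as `1 + c ≤ 2`, and for one boundary cell
  -- on each side of `0`.
  have hmass : ∀ (E : Set (ℤ → ↥(wordAt 0 (N * B) '' Y))) (F : Finset ℤ) (R : ℝ),
      (∀ j ∈ F, j ∈ freeSet b e ∧ ∀ ω ∈ E, ∀ ω' ∈ E, ∀ k : ℤ, N * (P * j) ≤ k →
        k < N * (P * (j + 1)) → Φ ω k = Φ ω' k) →
      R - 4 * Q ≤ Q * F.card →
      μ E ≤ ENNReal.ofReal (Real.exp (4 * u' * Q) * Real.exp (-u' * R)) := by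
    intro E F R hF hR
    refine (hμ E F fun ω hω ω' hω' j hj => ?_).trans (ENNReal.ofReal_le_ofReal ?_)
    · obtain ⟨hjf, hj⟩ := hF j hj
      apply Subtype.ext
      rw [← (hΦ ω).2.2 j hjf, ← (hΦ ω').2.2 j hjf, wordAt_eq_iff]
      intro k hk hk'
      refine hj ω hω ω' hω' k hk (hk'.trans_le ?_)
      push_cast
      have : (B : ℤ) ≤ P := by omega
      have h2 : (N : ℤ) * B ≤ N * P := by gcongr
      linarith
    · rw [← Real.exp_add, Real.exp_le_exp]
      have h1 : u' * Q * F.card ≤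
          Real.log (Nat.card ↥(wordAt 0 (N * B) '' Y)) * F.card := by gcongr
      have h2 : u' * (R - 4 * Q) ≤ u' * (Q * F.card) := by gcongr
      linarith
  have hcount := fun i : ℕ => le_card_free hc0 hc1 hbe hbe0 hbes i
  -- the free cells with index in `[1, i)`
  let pf : ℕ → Finset ℕ := fun i =>
    ((Finset.range i).filter fun j : ℕ => (j : ℤ) ∈ freeSet b e).erase 0
  have hpf : ∀ i : ℕ, c * i - 1 ≤ (pf i).card := by
    intro i
    have h1 := hcount i
    have h2 := Finset.pred_card_le_card_erase (a := 0)
      (s := (Finset.range i).filter fun j : ℕ => (j : ℤ) ∈ freeSet b e)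
    have h3 : (((Finset.range i).filter fun j : ℕ => (j : ℤ) ∈ freeSet b e).card : ℝ) ≤
        (pf i).card + 1 := by
      exact_mod_cast Nat.sub_le_iff_le_add.1 h2
    linarith
  have hdiv : ∀ n : ℕ, n - Q ≤ Q * (n / (N * P) : ℕ) := by
    intro n
    have h1 := (Nat.lt_mul_div_succ n (Nat.mul_pos hN hP0)).le
    have h2 : (n : ℝ) ≤ (N * P) * ((n / (N * P) : ℕ) + 1) := by exact_mod_cast h1
    rw [hQ]
    linarith
  have hpfmem : ∀ n : ℕ, ∀ j ∈ pf (n / (N * P)), (j : ℤ) ∈ freeSet b e ∧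
      ∀ k : ℤ, N * (P * (j : ℤ)) ≤ k → k < N * (P * ((j : ℤ) + 1)) → a + 1 ≤ k ∧ k < n := by
    intro n j hj
    obtain ⟨hj0, hj⟩ := Finset.mem_erase.1 hj
    obtain ⟨hjn, hjf⟩ := Finset.mem_filter.1 hj
    refine ⟨hjf, fun k hk hk' => ⟨?_, ?_⟩⟩
    -- Without the cell `0`, coordinates are at least `N > a` and stay positive after the
    -- translation by `a`.
    · have h1 : N * 1 ≤ N * (P * j) := by
        gcongr
        exact Nat.mul_pos hP0 (Nat.pos_of_ne_zero hj0)
      have h2 : (N : ℤ) ≤ N * (P * (j : ℤ)) := by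
        rw [mul_one] at h1
        exact_mod_cast h1
      omega
    · have h1 : N * (P * (j + 1)) ≤ n := by
        have h2 : j + 1 ≤ n / (N * P) := Finset.mem_range.1 hjn
        calc N * (P * (j + 1)) = (N * P) * (j + 1) := by ring
          _ ≤ (N * P) * (n / (N * P)) := Nat.mul_le_mul_left _ h2
          _ ≤ n := Nat.mul_div_le _ _
      have h3 : (N : ℤ) * (P * ((j : ℤ) + 1)) ≤ n := by exact_mod_cast h1
      omega
  refine ⟨B, μ, fun ω => translate a (Φ ω), Real.exp (4 * u' * Q), hμ1, ?_, Real.exp_pos _,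
    ?_, ?_⟩
  · intro ω
    refine mem_iInter.2 fun j => ⟨hX.translate_mem _ (hYX (hΦ ω).1), ?_⟩
    refine Set.infinite_of_forall_exists_gt fun m => ?_
    set k := Nat.pair j (m + a + 1) with hk
    have hJk : J k = j := by simp [J, hk]
    refine ⟨τ k, ⟨hJk ▸ (hτ k).1, ?_⟩, ?_⟩
    · rw [← hJk]
      -- Agreement on `|i| ≤ r` gives distance at most `exp (-(r + 1))`, which the floor makes
      -- strictly smaller than `φ`.
      have hle : dist (shift^[τ k] (translate a (Φ ω))) (z (J k) (τ k)) ≤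
          Real.exp (-((r (J k) (τ k) + 1 : ℕ) : ℝ)) := by
        rw [dist_le_exp_iff]
        intro i hi
        have hrle : r (J k) (τ k) ≤ τ k := by
          have h1 := (hrlog (J k) (τ k)).trans (hτ k).2.1
          have h2 : t * τ k ≤ 1 * τ k := by gcongr
          have : (r (J k) (τ k) : ℝ) ≤ τ k := by linarith
          exact_mod_cast this
        have hv1 : N * v k ≤ τ k + a - r (J k) (τ k) := Nat.mul_div_le _ _
        have hv2 : τ k + a + r (J k) (τ k) < N * (v k + ℓ k) := by
          have h1 : v k ≤ (τ k + a + r (J k) (τ k)) / N := Nat.div_le_div_right (by omega)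
          have h2 : v k + ℓ k = (τ k + a + r (J k) (τ k)) / N + 1 := by
            simp only [ℓ, ℓ', v] at h1 ⊢
            omega
          rw [h2]
          exact Nat.lt_mul_div_succ _ hN
        have hv1' : (N : ℤ) * v k ≤ τ k + a - r (J k) (τ k) := by
          rw [← Nat.cast_mul]
          omega
        have hv2' : (τ k : ℤ) + a + r (J k) (τ k) < N * (v k + ℓ k : ℤ) := by exact_mod_cast hv2
        have := (hΦ ω).2.1 k (i + τ k + a) (by omega) (by omega)
        simp only [shift_iterate_apply, translate_apply]
        rw [this, translate_apply]
        congr 1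
        ring
      refine hle.trans_lt ?_
      rw [← Real.lt_log_iff_exp_lt (hφ _ _).1]
      have := Nat.lt_floor_add_one (-Real.log (φ (J k) (τ k)))
      push_cast
      simp only [r]
      linarith
    · have h1 : k ≤ b k := hb.id_le k
      have h2 : m + a + 1 ≤ k := Nat.right_le_pair _ _
      have h3 : b k ≤ τ k + a :=
        (Nat.div_le_self _ _).trans ((Nat.div_le_self _ _).trans (Nat.sub_le _ _))
      omega
  · intro E n hE
    have := hmass E ((pf (n / (N * P))).map Nat.castEmbedding) (c * n) ?_ ?_
    · convert this using 4
      ring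
    · intro j hj
      obtain ⟨i, hi, rfl⟩ := Finset.mem_map.1 hj
      obtain ⟨hif, hik⟩ := hpfmem n i hi
      refine ⟨hif, fun ω hω ω' hω' k hk hk' => ?_⟩
      obtain ⟨h1, h2⟩ := hik k hk hk'
      have := hE ω hω ω' hω' (k - a) (by omega) (by omega)
      simpa using this
    · rw [Finset.card_map]
      have h1 := hpf (n / (N * P))
      have h2 := hdiv n
      have h3 := mul_le_mul_of_nonneg_left h1 hQ0.le
      have h4 := mul_le_mul_of_nonneg_left h2 hc0
      have h5 : c * Q ≤ 1 * Q := by gcongr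
      linarith
  · intro E m hE
    set i : ℕ := m / (N * P) with hi
    have hi' : N * (P * i) ≤ m := by
      rw [← mul_assoc]
      exact Nat.mul_div_le _ _
    have hdisj : Disjoint ((pf i).map Nat.castEmbedding) (Finset.Ico (-((i - 1 : ℕ) : ℤ)) 0) := by
      rw [Finset.disjoint_left]
      intro j hj hj'
      obtain ⟨q, -, rfl⟩ := Finset.mem_map.1 hj
      have := (Finset.mem_Ico.1 hj').2
      simp at this
      omega
    -- Negative cells are never blocked and contribute the `1` of `1 + c`; the outermost one is left
    -- out to make room for the translation by `a`.
    have := hmass E (((pf i).map Nat.castEmbedding).disjUnion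
      (Finset.Ico (-((i - 1 : ℕ) : ℤ)) 0) hdisj) ((1 + c) * m) ?_ ?_
    · convert this using 4
      ring
    · intro j hj
      rcases Finset.mem_disjUnion.1 hj with hj | hj
      · obtain ⟨q, hq, rfl⟩ := Finset.mem_map.1 hj
        obtain ⟨hqf, hqk⟩ := hpfmem m q hq
        refine ⟨hqf, fun ω hω ω' hω' k hk hk' => ?_⟩
        obtain ⟨h1, h2⟩ := hqk k hk hk'
        have := hE ω hω ω' hω' (k - a) (by omega)
        simpa using this
      · obtain ⟨hj1, hj2⟩ := Finset.mem_Ico.1 hj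
        refine ⟨fun k hk => by omega, fun ω hω ω' hω' k hk hk' => ?_⟩
        have h1 : (N : ℤ) * (P * (1 - i)) ≤ N * (P * j) := by
          gcongr
          omega
        have h2 : (N : ℤ) * (P * (i : ℤ)) ≤ m := by exact_mod_cast hi'
        have h3 : (N : ℤ) * 1 ≤ N * P := by
          gcongr
          omega
        have h4 : (N : ℤ) * (P * (j + 1)) ≤ 0 := by
          refine mul_nonpos_of_nonneg_of_nonpos (by positivity)
            (mul_nonpos_of_nonneg_of_nonpos (by positivity) (by omega))
        have h5 : (N : ℤ) * (P * (1 - i)) = N * P - N * (P * i) := by ring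
        have := hE ω hω ω' hω' (k - a) (by omega)
        simpa using this
    · rw [Finset.card_disjUnion, Finset.card_map, Int.card_Ico]
      have h0 : (0 - -((i - 1 : ℕ) : ℤ)).toNat = i - 1 := by omega
      rw [h0]
      have h1 := hpf i
      have h2 := hdiv m
      have h3 : (i : ℝ) - 1 ≤ ((i - 1 : ℕ) : ℝ) := by
        have : (i : ℝ) ≤ ((i - 1 : ℕ) : ℝ) + 1 := by exact_mod_cast (by omega : i ≤ i - 1 + 1)
        linarith
      have h4 : (c * i - 1) + (i - 1) ≤ (((pf i).card + (i - 1) : ℕ) : ℝ) := by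
        rw [Nat.cast_add]
        linarith
      have h5 := mul_le_mul_of_nonneg_left h4 hQ0.le
      have h6 := mul_le_mul_of_nonneg_left h2 (by linarith : (0 : ℝ) ≤ 1 + c)
      have h7 : c * Q ≤ 1 * Q := by gcongr
      linarith

end TwoSided

/-! ### Passing to the limit in the decay rate -/

/-- If `τ = 0` nothing lies between `0` and `τ`, and the bound at `t = 0` is used directly. -/
theorem le_ofReal_of_forall_lt {B : ℝ≥0∞} {f : ℝ → ℝ} {τ : ℝ} (hτ : 0 ≤ τ)
    (hf : ContinuousAt f τ)
    (h : ∀ t, 0 ≤ t → t ≤ τ → (t = 0 ∨ t < τ) → B ≤ ENNReal.ofReal (f t)) :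
    B ≤ ENNReal.ofReal (f τ) := by
  rcases hτ.eq_or_lt with rfl | hτ0
  · exact h 0 le_rfl le_rfl (Or.inl rfl)
  · refine ge_of_tendsto (ENNReal.tendsto_ofReal
      (hf.tendsto.mono_left (nhdsWithin_le_nhds (s := Iio τ)))) ?_
    filter_upwards [Ioo_mem_nhdsLT hτ0] with t ht
    exact h t ht.1.le ht.2.le (Or.inr ht.2)

theorem ofReal_le_of_forall_gt {B : ℝ≥0∞} {f : ℝ → ℝ} {τ : ℝ} (hτ : τ < 1)
    (hf : ContinuousAt f τ) (h : ∀ t, τ < t → t < 1 → ENNReal.ofReal (f t) ≤ B) :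
    ENNReal.ofReal (f τ) ≤ B := by
  refine le_of_tendsto (ENNReal.tendsto_ofReal
    (hf.tendsto.mono_left (nhdsWithin_le_nhds (s := Ioi τ)))) ?_
  filter_upwards [Ioo_mem_nhdsGT hτ] with t ht
  exact h t ht.1 ht.2

theorem ofReal_entropy_factor {τ u : ℝ} (hτ0 : 0 ≤ τ) (hτ1 : τ ≤ 1) :
    (1 - ENNReal.ofReal τ) / (1 + ENNReal.ofReal τ) * ENNReal.ofReal u =
      ENNReal.ofReal ((1 - τ) / (1 + τ) * u) := by
  rw [← ENNReal.ofReal_one, ← ENNReal.ofReal_sub _ hτ0, ← ENNReal.ofReal_add zero_le_one hτ0,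
    ← ENNReal.ofReal_div_of_pos (by linarith),
    ← ENNReal.ofReal_mul (div_nonneg (by linarith) (by linarith))]

theorem ofReal_dim_factor {τ u : ℝ} (hτ0 : 0 ≤ τ) :
    2 / (1 + ENNReal.ofReal τ) * ENNReal.ofReal u = ENNReal.ofReal (2 / (1 + τ) * u) := by
  rw [show (2 : ℝ≥0∞) = ENNReal.ofReal 2 by simp, ← ENNReal.ofReal_one,
    ← ENNReal.ofReal_add zero_le_one hτ0, ← ENNReal.ofReal_div_of_pos (by linarith),
    ← ENNReal.ofReal_mul (div_nonneg (by norm_num) (by linarith))]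

/-! ### Bounds for the intersection of the target sets in terms of the decay rates -/

namespace TwoSided

variable {A : Type*}

theorem exists_subset_hits {X : Set (TwoSided A)} {φ : ℕ → ℕ → ℝ}
    (hφ : ∀ j n, 0 < φ j n ∧ φ j n ≤ 1) {z : ℕ → ℕ → TwoSided A} {S : ℕ → Set ℕ} {t : ℝ}
    (ht0 : 0 ≤ t) (ht : t = 0 ∨ ENNReal.ofReal t < lowerTau φ) :
    ∃ j, ⋂ j, shrinkingTargetSet shift X (φ j) (z j) (S j) ⊆
      {x | ∃ᶠ n in atTop, x ∈ hitSet X (z j) (fun n => ⌊t * n⌋₊) n} := by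
  obtain ⟨j, hj⟩ : ∃ j, t = 0 ∨ ENNReal.ofReal t < liminf (decayRate (φ j)) atTop := by
    rcases ht with h | h
    · exact ⟨0, Or.inl h⟩
    · obtain ⟨j, hj⟩ := lt_iSup_iff.1 h
      exact ⟨j, Or.inr hj⟩
  exact ⟨j, (iInter_subset _ j).trans
    (shrinkingTargetSet_subset (eventually_le_exp_floor (hφ j) ht0 hj))⟩

theorem upper_bounds [Finite A] {X : Set (TwoSided A)} (hX : IsSubshift X) {u : ℝ} (hu0 : 0 ≤ u)
    (hu : Tendsto (fun n : ℕ => Real.log (numWords X 0 n) / n) atTop (𝓝 u)) {φ : ℕ → ℕ → ℝ}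
    (hφ : ∀ j n, 0 < φ j n ∧ φ j n ≤ 1) {z : ℕ → ℕ → TwoSided A} {S : ℕ → Set ℕ} {τ : ℝ}
    (hτ0 : 0 ≤ τ) (hτ1 : τ ≤ 1) (hτ : ENNReal.ofReal τ ≤ lowerTau φ) :
    bowenEntropy shift X (⋂ j, shrinkingTargetSet shift X (φ j) (z j) (S j)) ≤
        ENNReal.ofReal ((1 - τ) / (1 + τ) * u) ∧
      dimH (⋂ j, shrinkingTargetSet shift X (φ j) (z j) (S j)) ≤
        ENNReal.ofReal (2 / (1 + τ) * u) := by
  have hex : ∀ t, 0 ≤ t → (t = 0 ∨ t < τ) →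
      ∃ j, ⋂ j, shrinkingTargetSet shift X (φ j) (z j) (S j) ⊆
        {x | ∃ᶠ n in atTop, x ∈ hitSet X (z j) (fun n => ⌊t * n⌋₊) n} := fun t ht0 ht =>
    exists_subset_hits hφ ht0 (ht.imp_right fun h =>
      ((ENNReal.ofReal_lt_ofReal_iff_of_nonneg ht0).2 h).trans_le hτ)
  have h1τ : 1 + τ ≠ 0 := by positivity
  constructor
  · refine le_ofReal_of_forall_lt (f := fun t => (1 - t) / (1 + t) * u) hτ0
      (by fun_prop (disch := assumption)) fun t ht0 htτ ht => ?_
    obtain ⟨j, hj⟩ := hex t ht0 ht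
    exact bowenEntropy_le_of_hits hX hu0 hu ht0 (htτ.trans hτ1) hj
  · refine le_ofReal_of_forall_lt (f := fun t => 2 / (1 + t) * u) hτ0
      (by fun_prop (disch := assumption)) fun t ht0 htτ ht => ?_
    obtain ⟨j, hj⟩ := hex t ht0 ht
    exact dimH_le_of_hits hX hu0 hu ht0 hj

theorem lower_bounds [Finite A] {X Y : Set (TwoSided A)} (hX : IsSubshift X) {N : ℕ} (hN : 0 < N)
    (hYne : Y.Nonempty) (hYX : Y ⊆ X) (hYN : shift^[N] '' Y = Y)
    (hXY : X = ⋃ l : Fin N, shift^[(l : ℕ)] '' Y) {p : ℕ → ℕ}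
    (hp : Tendsto (fun n : ℕ => (p n : ℝ) / n) atTop (𝓝 0)) (hglue : Gluing Y N p) {u : ℝ}
    (hu0 : 0 ≤ u) (hu : ∀ n : ℕ, Real.exp (u * n) ≤ numWords X 0 n)
    {φ : ℕ → ℕ → ℝ} (hφ : ∀ j n, 0 < φ j n ∧ φ j n ≤ 1) {z : ℕ → ℕ → TwoSided A} {S : ℕ → Set ℕ}
    {a : ℕ} (haN : a < N) {τ : ℝ} (hτ0 : 0 ≤ τ) (hτ1 : τ < 1)
    (hT : ∀ t, τ < t → ∀ j, {n : ℕ | n ∈ S j ∧ -Real.log (φ j n) ≤ t * n ∧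
      translate (-(n + a)) (z j n) ∈ Y}.Infinite) :
    (⋂ j, shrinkingTargetSet shift X (φ j) (z j) (S j)).Nonempty ∧
      ENNReal.ofReal ((1 - τ) / (1 + τ) * u) ≤
        bowenEntropy shift X (⋂ j, shrinkingTargetSet shift X (φ j) (z j) (S j)) ∧
      ENNReal.ofReal (2 / (1 + τ) * u) ≤
        dimH (⋂ j, shrinkingTargetSet shift X (φ j) (z j) (S j)) := by
  -- The factor `q` makes both `c < (1 - t) / (1 + t)` and, if `u > 0`, `u' < u` strict; then `q →
  -- 1`, and afterwards `t → τ`.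
  have hmass : ∀ t, τ < t → t < 1 → ∀ q : ℝ, 0 ≤ q → q < 1 →
      (⋂ j, shrinkingTargetSet shift X (φ j) (z j) (S j)).Nonempty ∧
      ENNReal.ofReal (q * ((1 - t) / (1 + t)) * (q * u)) ≤
        bowenEntropy shift X (⋂ j, shrinkingTargetSet shift X (φ j) (z j) (S j)) ∧
      ENNReal.ofReal ((1 + q * ((1 - t) / (1 + t))) * (q * u)) ≤
        dimH (⋂ j, shrinkingTargetSet shift X (φ j) (z j) (S j)) := by
    intro t hτt ht1 q hq0 hq1
    have ht0 : 0 ≤ t := hτ0.trans hτt.le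
    have h1t : 0 < 1 - t := by linarith
    have hct : q * ((1 - t) / (1 + t)) * (1 + t) = q * (1 - t) := by field_simp
    have hc1 : q * ((1 - t) / (1 + t)) ≤ 1 * 1 := by
      gcongr
      rw [div_le_one (by linarith)]
      linarith
    obtain ⟨B, μ, Φ, K, hμ, hΦ, hK, hent, hdim⟩ := exists_mass hX hN hYne hYX hYN hXY hp hglue hu
      hφ haN ht1 (hT t hτt) (c := q * ((1 - t) / (1 + t))) (u' := q * u) (by positivity)
      (by linarith) (by rw [hct]; nlinarith) (by positivity) (by
        rcases hu0.eq_or_lt with h | h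
        · left
          rw [← h, mul_zero]
        · right
          nlinarith)
    refine ⟨?_, le_bowenEntropy_of_mass μ hμ hΦ hK hent, le_dimH_of_mass μ hμ hΦ hK hdim⟩
    have : Nonempty ↥(wordAt 0 (N * B) '' Y) := (hYne.image _).to_subtype
    exact ⟨_, hΦ (Classical.arbitrary _)⟩
  have h1τ : 1 + τ ≠ 0 := by positivity
  have hlimq : ∀ {B : ℝ≥0∞} {f : ℝ → ℝ}, Continuous f →
      (∀ q, 0 ≤ q → q < 1 → ENNReal.ofReal (f q) ≤ B) → ENNReal.ofReal (f 1) ≤ B := by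
    intro B f hf h
    refine le_of_tendsto (ENNReal.tendsto_ofReal
      ((hf.tendsto 1).mono_left (nhdsWithin_le_nhds (s := Iio 1)))) ?_
    filter_upwards [Ioo_mem_nhdsLT zero_lt_one] with q hq
    exact h q hq.1.le hq.2
  refine ⟨?_, ?_, ?_⟩
  · obtain ⟨t, ht, ht'⟩ := exists_between hτ1
    exact (hmass t ht ht' 0 le_rfl one_pos).1
  · refine ofReal_le_of_forall_gt (f := fun t => (1 - t) / (1 + t) * u) hτ1
      (by fun_prop (disch := assumption)) fun t ht ht' => ?_
    have := hlimq (f := fun q => q * ((1 - t) / (1 + t)) * (q * u)) (by fun_prop)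
      fun q hq hq' => (hmass t ht ht' q hq hq').2.1
    simpa using this
  · refine ofReal_le_of_forall_gt (f := fun t => 2 / (1 + t) * u) hτ1
      (by fun_prop (disch := assumption)) fun t ht ht' => ?_
    have := hlimq (f := fun q => (1 + q * ((1 - t) / (1 + t))) * (q * u)) (by fun_prop)
      fun q hq hq' => (hmass t ht ht' q hq hq').2.2
    convert this using 2
    have : 1 + t ≠ 0 := by linarith
    field_simp
    ring

/-- If `z_n = σ^(I₁) y` with `y ∈ Y` and `N ∣ n - I₂`, then `I₁ - n` is congruent to `d = I₁ - I₂`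
modulo `N`, so the residue of `d` brings `z_n` back into `Y`. The limsup controls all late times,
hence those of any index sequence. -/
theorem infinite_hits_of_upperTau {Y : Set (TwoSided A)} {N : ℕ} (hN : 0 < N)
    (hYN : shift^[N] '' Y = Y) {φ : ℕ → ℕ → ℝ} {z : ℕ → ℕ → TwoSided A} {s : ℕ → ℕ → ℕ}
    (hs : ∀ j, Tendsto (s j) atTop atTop) {d : ℤ}
    (hd : d ∈ ⋂ j, indexDiffSet shift Y N (z j) (s j)) {t : ℝ} (ht0 : 0 < t)
    (ht : upperTau φ < ENNReal.ofReal t) (j : ℕ) :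
    {n : ℕ | n ∈ range (s j) ∧ -Real.log (φ j n) ≤ t * n ∧
      translate (-(n + (d % N).toNat)) (z j n) ∈ Y}.Infinite := by
  obtain ⟨⟨I₁, I₂⟩, ⟨-, -, hinf⟩, hI⟩ := mem_iInter.1 hd j
  simp only at hinf hI
  have hN' : (0 : ℤ) < N := by exact_mod_cast hN
  have hev : ∀ᶠ n : ℕ in atTop, -Real.log (φ j n) ≤ t * n := by
    have hlt : limsup (decayRate (φ j)) atTop < ENNReal.ofReal t :=
      (le_iSup (fun j => limsup (decayRate (φ j)) atTop) j).trans_lt ht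
    filter_upwards [eventually_lt_of_limsup_lt hlt, eventually_gt_atTop 0] with n hn hn0
    have hn' : (0 : ℝ) < n := by exact_mod_cast hn0
    unfold decayRate at hn
    rw [ENNReal.ofReal_lt_ofReal_iff ht0, div_lt_iff₀ hn'] at hn
    exact hn.le
  rw [← Nat.frequently_atTop_iff_infinite]
  refine (hs j).frequently
    (((Nat.frequently_atTop_iff_infinite.2 hinf).and_eventually ((hs j).eventually hev)).mono ?_)
  rintro i ⟨⟨⟨y, hy, hyz⟩, hdvd⟩, hlog⟩
  refine ⟨mem_range_self i, hlog, ?_⟩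
  beta_reduce at hyz
  rw [← hyz, shift_iterate, translate_translate]
  obtain ⟨q, hq⟩ := hdvd
  have hmod : ((d % N).toNat : ℤ) = d - N * (d / N) := by
    rw [Int.toNat_of_nonneg (Int.emod_nonneg _ hN'.ne'), Int.emod_def]
  have := translate_mem hYN (d / N - q) hy
  convert this using 2
  rw [hmod, mul_sub, ← hq, ← hI]
  ring

/-- With `Y = X` membership is automatic, and `S j` contains the infinitely many times that the
liminf provides. -/
theorem infinite_hits_of_lowerTau {X : Set (TwoSided A)} (hX : IsSubshift X) {φ : ℕ → ℕ → ℝ}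
    {z : ℕ → ℕ → TwoSided A} (hz : ∀ j i, z j i ∈ X) {S : ℕ → Set ℕ} (hS : ∀ j, Ioi 0 ⊆ S j)
    {t : ℝ} (ht0 : 0 < t) (ht : lowerTau φ < ENNReal.ofReal t) (j : ℕ) :
    {n : ℕ | n ∈ S j ∧ -Real.log (φ j n) ≤ t * n ∧
      translate (-(n + (0 : ℕ))) (z j n) ∈ X}.Infinite := by
  have hlt : liminf (decayRate (φ j)) atTop < ENNReal.ofReal t :=
    (le_iSup (fun j => liminf (decayRate (φ j)) atTop) j).trans_lt ht
  rw [← Nat.frequently_atTop_iff_infinite]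
  refine ((frequently_lt_of_liminf_lt (by isBoundedDefault) hlt).and_eventually
    (eventually_gt_atTop 0)).mono ?_
  rintro n ⟨hn, hn0⟩
  have hn' : (0 : ℝ) < n := by exact_mod_cast hn0
  unfold decayRate at hn
  rw [ENNReal.ofReal_lt_ofReal_iff ht0, div_lt_iff₀ hn'] at hn
  exact ⟨hS j hn0, hn.le, hX.translate_mem _ (hz j n)⟩

end TwoSided

theorem lowerTau_le_upperTau (φ : ℕ → ℕ → ℝ) : lowerTau φ ≤ upperTau φ :=
  iSup_mono fun _ => liminf_le_limsup

end ShrinkingTarget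

open ShrinkingTarget ShrinkingTarget.TwoSided in
theorem theorem1p17 {A : Type*} [Finite A]
    (X Y : Set (ShrinkingTarget.TwoSided A)) (N : ℕ)
    (hX : ShrinkingTarget.TwoSided.IsSubshift X)
    (hY_ne : Y.Nonempty) (hY_compact : IsCompact Y) (hYX : Y ⊆ X) (hN : 0 < N)
    (hYN : (ShrinkingTarget.TwoSided.shift (A := A))^[N] '' Y = Y)
    (hXY : X = ⋃ l : Fin N, (ShrinkingTarget.TwoSided.shift (A := A))^[(l : ℕ)] '' Y)
    (hspec : ShrinkingTarget.NonUniformSpecification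
      (ShrinkingTarget.TwoSided.shift (A := A))^[N] Y)
    -- the data of the countably many shrinking target sets, `S_j` being the range of `s j`
    (φ : ℕ → ℕ → ℝ) (hφ : ∀ j n, 0 < φ j n ∧ φ j n ≤ 1)
    (z : ℕ → ℕ → ShrinkingTarget.TwoSided A) (hz : ∀ j i, z j i ∈ X)
    (s : ℕ → ℕ → ℕ) (hs : ∀ j, Tendsto (s j) atTop atTop)
    (W : Set (ShrinkingTarget.TwoSided A))
    (hW : W = ⋂ j, ShrinkingTarget.shrinkingTargetSet ShrinkingTarget.TwoSided.shift X
      (φ j) (z j) (Set.range (s j)))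
    (τu τl h : ℝ≥0∞)
    (hτu : τu = ShrinkingTarget.upperTau φ) (hτl : τl = ShrinkingTarget.lowerTau φ)
    (hh : h = ShrinkingTarget.topEntropy ShrinkingTarget.TwoSided.shift X) :
    (τu < 1 →
      (⋂ j, ShrinkingTarget.indexDiffSet ShrinkingTarget.TwoSided.shift Y N
        (z j) (s j)).Nonempty →
      W.Nonempty ∧
      (1 - τu) / (1 + τu) * h ≤
        ShrinkingTarget.bowenEntropy ShrinkingTarget.TwoSided.shift X W ∧
      ShrinkingTarget.bowenEntropy ShrinkingTarget.TwoSided.shift X W ≤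
        (1 - τl) / (1 + τl) * h ∧
      2 / (1 + τu) * h ≤ dimH W ∧
      dimH W ≤ 2 / (1 + τl) * h ∧
      -- `S_j = ℕ`, whether or not `0` is counted as a natural number
      (Y = X → N = 1 → (∀ j, Set.Ioi 0 ⊆ Set.range (s j)) →
        ShrinkingTarget.bowenEntropy ShrinkingTarget.TwoSided.shift X W =
          (1 - τl) / (1 + τl) * h ∧
        dimH W = 2 / (1 + τl) * h)) ∧
    (τl = 1 →
      ShrinkingTarget.bowenEntropy ShrinkingTarget.TwoSided.shift X W = 0 ∧ dimH W ≤ h) ∧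
    (1 < τl →
      ShrinkingTarget.bowenEntropy ShrinkingTarget.TwoSided.shift X W = 0 ∧ dimH W = 0) := by
  have hXne : X.Nonempty := hY_ne.mono hYX
  obtain ⟨u, hu0, hu, hule⟩ := exists_wordGrowth hX hXne
  have hhu : h = ENNReal.ofReal u := hh.trans (topEntropy_eq hX hu)
  obtain ⟨p, hp, hglue⟩ := exists_gluing hN hY_ne hY_compact hYN hspec
  have hfinite : ∀ τ : ℝ≥0∞, τ ≤ 1 → ∃ r : ℝ, 0 ≤ r ∧ r ≤ 1 ∧ τ = ENNReal.ofReal r := fun τ hτ =>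
    ⟨τ.toReal, ENNReal.toReal_nonneg, ENNReal.toReal_mono ENNReal.one_ne_top hτ,
      (ENNReal.ofReal_toReal (ne_top_of_le_ne_top ENNReal.one_ne_top hτ)).symm⟩
  rw [hW]
  refine ⟨fun hτ1 hInd => ?_, fun hτ1 => ?_, fun hτ1 => ?_⟩
  · have hlu : τl ≤ τu := by
      rw [hτu, hτl]
      exact lowerTau_le_upperTau φ
    obtain ⟨r, hr0, -, hr⟩ := hfinite τu hτ1.le
    obtain ⟨q, hq0, hq1, hq⟩ := hfinite τl (hlu.trans hτ1.le)
    have hr1 : r < 1 := by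
      rw [hr, ← ENNReal.ofReal_one] at hτ1
      exact (ENNReal.ofReal_lt_ofReal_iff_of_nonneg hr0).1 hτ1
    have hq1' : q < 1 := by
      have := hlu.trans_lt hτ1
      rw [hq, ← ENNReal.ofReal_one] at this
      exact (ENNReal.ofReal_lt_ofReal_iff_of_nonneg hq0).1 this
    obtain ⟨d, hd⟩ := hInd
    have hN' : (0 : ℤ) < N := by exact_mod_cast hN
    have ha : (d % N).toNat < N := by
      have := Int.emod_lt_of_pos d hN'
      omega
    obtain ⟨hne, hlow, hlow'⟩ := lower_bounds hX hN hY_ne hYX hYN hXY hp hglue hu0 hule hφ ha hr0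
      hr1 (fun t ht j => infinite_hits_of_upperTau hN hYN hs hd (hr0.trans_lt ht) (by
        rw [← hτu, hr]
        exact (ENNReal.ofReal_lt_ofReal_iff_of_nonneg hr0).2 ht) j)
    obtain ⟨hup, hup'⟩ := upper_bounds hX hu0 hu hφ (z := z) (S := fun j => range (s j)) hq0 hq1
      (hq.symm.trans hτl).le
    rw [hhu, hr, hq, ofReal_entropy_factor hr0 hr1.le, ofReal_entropy_factor hq0 hq1,
      ofReal_dim_factor hr0, ofReal_dim_factor hq0]
    refine ⟨hne, hlow, hup, hlow', hup', fun hYX' _ hS => ?_⟩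
    subst hYX'
    obtain ⟨-, hl, hl'⟩ := lower_bounds hX hN hY_ne hYX hYN hXY hp hglue hu0 hule hφ hN hq0 hq1'
      (fun t ht j => infinite_hits_of_lowerTau hX hz hS (hq0.trans_lt ht) (by
        rw [← hτl, hq]
        exact (ENNReal.ofReal_lt_ofReal_iff_of_nonneg hq0).2 ht) j)
    exact ⟨le_antisymm hup hl, le_antisymm hup' hl'⟩
  -- At `τ = 1` the two factors are `0` and `1`.
  · obtain ⟨hup, hup'⟩ := upper_bounds hX hu0 hu hφ (z := z) (S := fun j => range (s j))
      zero_le_one le_rfl (by rw [ENNReal.ofReal_one, ← hτ1, hτl])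
    refine ⟨le_antisymm (by simpa using hup) bot_le, hup'.trans (le_of_eq ?_)⟩
    rw [hhu]
    norm_num
  · obtain ⟨hup, -⟩ := upper_bounds hX hu0 hu hφ (z := z) (S := fun j => range (s j))
      zero_le_one le_rfl (by rw [ENNReal.ofReal_one, ← hτl]; exact hτ1.le)
    refine ⟨le_antisymm (by simpa using hup) bot_le, ?_⟩
    -- A finite rate strictly between `1` and `τl` is taken, as `τl` may be infinite.
    obtain ⟨t, ht, ht'⟩ := ENNReal.lt_iff_exists_nnreal_btwn.1 hτ1
    have ht1 : (1 : ℝ) < t := by exact_mod_cast ht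
    obtain ⟨j, hj⟩ := exists_subset_hits (X := X) hφ (z := z) (S := fun j => range (s j))
      (t := (t : ℝ)) t.2 (Or.inr (by rwa [ENNReal.ofReal_coe_nnreal, ← hτl]))
    exact dimH_eq_zero_of_hits hu0 hu ht1 hj
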